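/- Let $M$ be a von Neumann algebra acting on a complex Hilbert space, equipped with a faithful normal trace $\tau$ (a trace means a tracial state). Write $\langle x,y\rangle_\tau=\tau(y^*x)$ and $\|x\|_2=\langle x,x\rangle_\tau^{1/2}$ for $x,y\in M$, and let $L^2(M,\tau)$ be the Hilbert space completion of $M$ for this inner product. A linear map $T\colon M\to M$ is called normal if it is ultraweakly continuous, and $\|T\|_{\mathrm{cb}}=\sup_n\|\mathrm{id}_{M_n}\otimes T\|$ is its completely bounded norm. The pair $(M,\tau)$ has the Haagerup property if there is a net $(T_\alpha)$ of normal completely positive maps $M\to M$ such that 1. $\tau\circ T_\alpha\le\tau$ on the positive elements of $M$, for every $\alpha$, 2. each $T_\alpha$ extends to a compact operator on $L^2(M,\tau)$, 3. $\|T_\alpha x-x\|_2\to 0$ for every $x\in M$. The pair $(M,\tau)$ has the weak Haagerup property if there are a constant $C>0$ and a net $(T_\alpha)$ of normal, completely bounded maps $M\to M$ such that 1. $\|T_\alpha\|_{\mathrm{cb}}\le C$ for every $\alpha$, 2. $\langle T_\alpha x,y\rangle_\tau=\langle x,T_\alpha y\rangle_\tau$ for all $x,y\in M$ and every $\alpha$,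 3. each $T_\alpha$ extends to a compact operator on $L^2(M,\tau)$, 4. $T_\alpha x\to x$ ultraweakly for every $x\in M$. The weak Haagerup constant $\Lambda_{\mathrm{WH}}(M,\tau)\in[0,\infty]$ is the infimum of those $C>0$ for which such a net exists, and $\infty$ if there is none. **Proposition.** If $(M,\tau)$ has the Haagerup property, then $(M,\tau)$ has the weak Haagerup property. In fact, $\Lambda_{\mathrm{WH}}(M,\tau)=1$. -/

import Mathlib

open scoped ComplexOrder Topology ENNReal CStarAlgebra

noncomputable section

universe u

namespace VonNeumannAlgebra

variable {H : Type u} [NormedAddCommGroup H] [InnerProductSpace ℂ H] [CompleteSpace H]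

/-! ### The C⋆-algebra structure of a von Neumann algebra

The algebraic operations, the norm, the involution and the order on (the type of elements of) a
von Neumann algebra `M` acting on `H` are those inherited from `B(H)`. -/

instance instSMulMemClass : SMulMemClass (VonNeumannAlgebra H) ℂ (H →L[ℂ] H) where
  smul_mem {s} r _ hx := s.toStarSubalgebra.smul_mem hx r

instance instIsClosed (M : VonNeumannAlgebra H) : IsClosed (M : Set (H →L[ℂ] H)) := by
  rw [← M.centralizer_centralizer]
  exact Set.isClosed_centralizer _

instance instCStarAlgebra (M : VonNeumannAlgebra H) : CStarAlgebra M :=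
  StarSubalgebra.cstarAlgebra M

instance instNonUnitalCStarAlgebra (M : VonNeumannAlgebra H) : NonUnitalCStarAlgebra M :=
  CStarAlgebra.toNonUnitalCStarAlgebra M

/-- The operator (Loewner) order inherited from `B(H)` turns a von Neumann algebra into a
star-ordered ring: its positive elements are the elements of the form `star s * s`. -/
instance instStarOrderedRing (M : VonNeumannAlgebra H) : StarOrderedRing M := by
  refine StarOrderedRing.of_le_iff fun x y => ⟨fun h => ?_, ?_⟩
  · have hz : (0 : H →L[ℂ] H) ≤ ((y - x : M) : H →L[ℂ] H) := by
      simpa using (sub_nonneg.mpr (show (x : H →L[ℂ] H) ≤ y from h))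
    have hmem : CFC.sqrt ((y - x : M) : H →L[ℂ] H) ∈ M := by
      rw [← SetLike.mem_coe, ← M.centralizer_centralizer, Set.mem_centralizer_iff]
      intro m hm
      have hc : Commute ((y - x : M) : H →L[ℂ] H) m :=
        (Set.mem_centralizer_iff.mp hm) _ (y - x : M).2
      exact (hc.cfcₙ_nnreal _).symm
    refine ⟨⟨_, hmem⟩, ?_⟩
    apply Subtype.ext
    have h1 : star (CFC.sqrt ((y - x : M) : H →L[ℂ] H)) * CFC.sqrt ((y - x : M) : H →L[ℂ] H)
        = ((y - x : M) : H →L[ℂ] H) := by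
      rw [(CFC.sqrt_nonneg ((y - x : M) : H →L[ℂ] H)).isSelfAdjoint.star_eq,
        CFC.sqrt_mul_sqrt_self _ hz]
    change (y : H →L[ℂ] H) = x + star (CFC.sqrt ((y - x : M) : H →L[ℂ] H)) *
      CFC.sqrt ((y - x : M) : H →L[ℂ] H)
    rw [h1]
    simp
  · rintro ⟨s, rfl⟩
    change (x : H →L[ℂ] H) ≤ x + star (s : H →L[ℂ] H) * s
    exact le_add_of_nonneg_right (star_mul_self_nonneg _)

/-! ### Ultraweak topology, normality -/

/-- The functional `x ↦ ∑ₙ ⟨x ξₙ, ηₙ⟩` on `M`, for square-summable sequences `ξ`, `η` of vectors. -/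
def ultraweakFunctional (M : VonNeumannAlgebra H) (ξ η : lp (fun _ : ℕ => H) 2) (x : M) : ℂ :=
  ∑' n, inner ℂ (η n) ((x : H →L[ℂ] H) (ξ n))

/-- The ultraweak (σ-weak) topology on `M`: the coarsest topology for which all functionals
`x ↦ ∑ₙ ⟨x ξₙ, ηₙ⟩` with `∑ ‖ξₙ‖² < ∞` and `∑ ‖ηₙ‖² < ∞` are continuous. -/
abbrev ultraweakTopology (M : VonNeumannAlgebra H) : TopologicalSpace M :=
  ⨅ p : lp (fun _ : ℕ => H) 2 × lp (fun _ : ℕ => H) 2,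
    TopologicalSpace.induced (M.ultraweakFunctional p.1 p.2) inferInstance

/-- A linear map `T : M → M` is normal if it is continuous for the ultraweak topology. -/
def IsNormalMap (M : VonNeumannAlgebra H) (T : M →ₗ[ℂ] M) : Prop :=
  Continuous[M.ultraweakTopology, M.ultraweakTopology] T

/-! ### Complete boundedness -/

/-- The completely bounded norm `‖T‖_cb = supₙ ‖id ⊗ T : Mₙ(M) → Mₙ(M)‖ ∈ [0, ∞]`, where `Mₙ(M)`
carries its C⋆-norm. -/
def cbNorm (M : VonNeumannAlgebra H) (T : M →ₗ[ℂ] M) : ℝ≥0∞ :=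
  ⨆ (n : ℕ) (X : CStarMatrix (Fin n) (Fin n) M) (_ : ‖X‖ ≤ 1), ‖X.map T‖ₑ

/-- `T` is completely bounded if `‖T‖_cb < ∞`. -/
def IsCompletelyBounded (M : VonNeumannAlgebra H) (T : M →ₗ[ℂ] M) : Prop :=
  M.cbNorm T < ∞

/-! ### Traces and the space `L²(M, τ)` -/

/-- A faithful normal trace on `M`; a trace means a tracial state. -/
structure IsFaithfulNormalTrace (M : VonNeumannAlgebra H) (τ : M →ₚ[ℂ] ℂ) : Prop where
  map_one : τ 1 = 1
  tracial : ∀ x y : M, τ (x * y) = τ (y * x)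
  faithful : ∀ x : M, τ (star x * x) = 0 → x = 0
  normal : Continuous[M.ultraweakTopology, inferInstance] τ

/-- The canonical linear map `M → L²(M, τ)`. Here `L²(M, τ)` is the Hilbert space `τ.GNS`, the
completion of `M` for the inner product `⟨x, y⟩_τ = τ (star y * x)`. -/
def toL2 (M : VonNeumannAlgebra H) (τ : M →ₚ[ℂ] ℂ) (x : M) : τ.GNS :=
  ((τ.toPreGNS x : τ.PreGNS) : UniformSpace.Completion τ.PreGNS)

/-- `T : M → M` extends to a compact operator on `L²(M, τ)`. -/
def ExtendsToCompact (M : VonNeumannAlgebra H) (τ : M →ₚ[ℂ] ℂ) (T : M →ₗ[ℂ] M) : Prop :=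
  ∃ S : τ.GNS →L[ℂ] τ.GNS, IsCompactOperator S ∧ ∀ x : M, S (M.toL2 τ x) = M.toL2 τ (T x)

/-! ### The Haagerup property and the weak Haagerup property -/

/-- `(M, τ)` has the Haagerup property: there is a net `(T_α)` of normal completely positive maps
on `M` with `τ ∘ T_α ≤ τ` (on the positive cone), each extending to a compact operator on
`L²(M, τ)`, and `‖T_α x - x‖₂ → 0` for all `x ∈ M`. -/
def HasHaagerupProperty (M : VonNeumannAlgebra H) (τ : M →ₚ[ℂ] ℂ) : Prop :=
  ∃ (A : Type u) (_ : Preorder A) (_ : IsDirectedOrder A) (_ : Nonempty A) (T : A → (M →CP M)),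
    (∀ a, M.IsNormalMap (T a).toLinearMap) ∧
    (∀ a, ∀ x : M, 0 ≤ x → τ (T a x) ≤ τ x) ∧
    (∀ a, M.ExtendsToCompact τ (T a).toLinearMap) ∧
    (∀ x : M, Filter.Tendsto (fun a => ‖M.toL2 τ (T a x - x)‖) Filter.atTop (𝓝 0))

/-- There is a net `(T_α)` of normal completely bounded maps on `M` with `‖T_α‖_cb ≤ C`,
`⟨T_α x, y⟩_τ = ⟨x, T_α y⟩_τ`, each extending to a compact operator on `L²(M, τ)`, and
`T_α x → x` ultraweakly for all `x ∈ M`. -/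
def HasWeakHaagerupNet (M : VonNeumannAlgebra H) (τ : M →ₚ[ℂ] ℂ) (C : ℝ) : Prop :=
  ∃ (A : Type u) (_ : Preorder A) (_ : IsDirectedOrder A) (_ : Nonempty A) (T : A → (M →ₗ[ℂ] M)),
    (∀ a, M.IsNormalMap (T a)) ∧
    (∀ a, M.IsCompletelyBounded (T a)) ∧
    (∀ a, M.cbNorm (T a) ≤ ENNReal.ofReal C) ∧
    (∀ a, ∀ x y : M, τ (star y * T a x) = τ (star (T a y) * x)) ∧
    (∀ a, M.ExtendsToCompact τ (T a)) ∧
    (∀ x : M, Filter.Tendsto (fun a => T a x) Filter.atTop (@nhds M M.ultraweakTopology x))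

/-- `(M, τ)` has the weak Haagerup property. -/
def HasWeakHaagerupProperty (M : VonNeumannAlgebra H) (τ : M →ₚ[ℂ] ℂ) : Prop :=
  ∃ C : ℝ, 0 < C ∧ M.HasWeakHaagerupNet τ C

/-- The weak Haagerup constant `Λ_WH(M, τ)`: the infimum of the constants `C > 0` for which a net
as above exists, and `∞` if there is none. -/
def weakHaagerupConstant (M : VonNeumannAlgebra H) (τ : M →ₚ[ℂ] ℂ) : ℝ≥0∞ :=
  ⨅ (C : ℝ) (_ : 0 < C) (_ : M.HasWeakHaagerupNet τ C), ENNReal.ofReal C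

end VonNeumannAlgebra

end

/-! ### Complete positivity tested by the trace, and complete contractivity -/

noncomputable section

/-! Each completely positive `T` of a Haagerup net is replaced by a symmetric completely contractive
map.

The maps `T` need not be contractive, so `T` is cut down to `T₁ x = a * T x * a` with `a = max(1, T
1)^(-1/2)` (`exists_cutoff`). Then `T₁ 1 ≤ 1` and still `τ ∘ T₁ ≤ τ`. Moreover `T₁` stays compact on
`L²` and is as close to the identity in `‖·‖₂` as `T` is, up to a multiple of `‖T 1 - 1‖₂`
(`exists_contractive_cutoff`).

The inequality `τ ∘ T₁ ≤ τ` says by duality that the `L²`-adjoint of `T₁` maps the operator interval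
`[0, 1]` to itself: a Hahn–Banach argument that needs this interval to be closed in `L²`. So the
adjoint restricts to a map `T₂` on `M` with `T₂ 1 ≤ 1` (`exists_adjoint`). Complete positivity,
expressed by pairing with `τ`, is self-dual and passes to `T₂`; together with `T 1 ≤ 1` it gives
complete contractivity (`norm_map_le_one`).

The map `R = T₂ ∘ T₁` is symmetric, compact and completely contractive. It is normal because it has
a trace adjoint, namely itself, and because the functionals `τ (z * ·)` are norm dense in the
ultraweakly continuous ones (`isNormalMap_of_adjoint`). Since `⟨R x, y⟩ = ⟨T₁ x, T₁ y⟩` tends to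
`⟨x, y⟩` and the net is bounded, `R x → x` ultraweakly. Hence the constant is at most `1`;
evaluating at `1` shows that it is at least `1`. -/

/-- A faithful tracial state on a C⋆-algebra. -/
structure PositiveLinearMap.IsFaithfulTracialState {A : Type*} [CStarAlgebra A] [PartialOrder A]
    [StarOrderedRing A] (τ : A →ₚ[ℂ] ℂ) : Prop where
  map_one : τ 1 = 1
  tracial : ∀ x y : A, τ (x * y) = τ (y * x)
  faithful : ∀ x : A, τ (star x * x) = 0 → x = 0

lemma NonUnitalCStarAlgebra.exists_eq_star_mul_self {B : Type*} [NonUnitalCStarAlgebra B]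
    [PartialOrder B] [StarOrderedRing B] {b : B} (hb : 0 ≤ b) : ∃ c, b = star c * c :=
  CStarAlgebra.nonneg_iff_eq_star_mul_self.mp hb

namespace PositiveLinearMap

variable {A : Type*} [CStarAlgebra A] [PartialOrder A] {τ : A →ₚ[ℂ] ℂ}

lemma re_nonneg_of_nonneg (τ : A →ₚ[ℂ] ℂ) {x : A} (hx : 0 ≤ x) : 0 ≤ (τ x).re :=
  (Complex.nonneg_iff.mp (map_nonneg τ hx)).1

/-- A linear map `T` on `A` is completely positive when paired with `τ`. -/
def IsTraceCompletelyPositive (τ : A →ₚ[ℂ] ℂ) (T : A →ₗ[ℂ] A) : Prop :=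
  ∀ (ι : Type) [Fintype ι] (r u : ι → A),
    0 ≤ (∑ l, ∑ k, τ (star (u l) * T (star (r l) * r k) * u k)).re

lemma IsTraceCompletelyPositive.conj {T : A →ₗ[ℂ] A} (hT : τ.IsTraceCompletelyPositive T) (a : A) :
    τ.IsTraceCompletelyPositive
      (LinearMap.mulRight ℂ a ∘ₗ LinearMap.mulLeft ℂ (star a) ∘ₗ T) := by
  intro ι _ r u
  convert hT ι r (fun i => a * u i) using 5
  simp [mul_assoc]

variable [StarOrderedRing A]

lemma re_mono (τ : A →ₚ[ℂ] ℂ) {x y : A} (hxy : x ≤ y) : (τ x).re ≤ (τ y).re := by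
  have := τ.re_nonneg_of_nonneg (sub_nonneg.mpr hxy)
  simpa using this

lemma re_star (τ : A →ₚ[ℂ] ℂ) (x : A) : (τ (star x)).re = (τ x).re := by
  rw [map_star]; simp

namespace IsFaithfulTracialState

/-- Take `c` with `z⁻ = star c * c`. Traciality turns the hypothesis into `0 ≤ τ (z⁻ * z) = -τ (z⁻ *
z⁻)`, and faithfulness gives `z⁻ = 0`. -/
lemma nonneg_of_conjugate_nonneg (h : τ.IsFaithfulTracialState) {z : A} (hz : IsSelfAdjoint z)
    (hc : ∀ c, 0 ≤ (τ (c * z * star c)).re) : 0 ≤ z := by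
  have hw : (0 : A) ≤ z⁻ := CFC.negPart_nonneg z
  obtain ⟨c, hcw⟩ := CStarAlgebra.nonneg_iff_eq_star_mul_self.mp hw
  have h1 := hc c
  rw [h.tracial, ← mul_assoc, ← hcw] at h1
  have h2 : z⁻ * z = -(star z⁻ * z⁻) := by
    rw [hw.isSelfAdjoint.star_eq]
    nth_rewrite 2 [← CFC.posPart_sub_negPart z hz]
    rw [mul_sub, CFC.negPart_mul_posPart, zero_sub]
  rw [h2, map_neg] at h1
  have h3 := map_nonneg τ (star_mul_self_nonneg (z⁻))
  have h4 : z⁻ = 0 := by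
    refine h.faithful _ (Complex.ext ?_ ?_)
    · simp only [Complex.neg_re] at h1
      have := (Complex.nonneg_iff.mp h3).1
      simp only [Complex.zero_re]; linarith
    · exact (Complex.nonneg_iff.mp h3).2.symm
  rw [← CFC.posPart_sub_negPart z hz, h4, sub_zero]
  exact CFC.posPart_nonneg z

open WithCStarModule CStarMatrix in
/-- A criterion for contractivity of a matrix over a C⋆-algebra with a faithful tracial state. -/
lemma cstarMatrix_norm_le_one (h : τ.IsFaithfulTracialState) {n : Type*} [Fintype n]
    (X : CStarMatrix n n A)
    (hX : ∀ v w : n → A, 0 ≤ ∑ i, (τ (v i * star (v i))).re + ∑ j, (τ (w j * star (w j))).re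
      + 2 * (∑ i, ∑ j, τ (v i * X i j * star (w j))).re) : ‖X‖ ≤ 1 := by
  rw [norm_def]
  refine (toCLM X).opNorm_le_bound zero_le_one fun v => ?_
  rw [one_mul, pi_norm, pi_norm]
  refine Real.sqrt_le_sqrt ?_
  have hle : ∀ u : C⋆ᵐᵒᵈ(A, n → A), 0 ≤ ∑ i, u i * star (u i) :=
    fun u => Finset.sum_nonneg fun i _ => mul_star_self_nonneg _
  simp only [inner_def]
  refine CStarAlgebra.norm_le_norm_of_nonneg_of_le (hle _) ?_
  rw [← sub_nonneg]
  refine h.nonneg_of_conjugate_nonneg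
    ((IsSelfAdjoint.of_nonneg (hle _)).sub (IsSelfAdjoint.of_nonneg (hle _))) fun c => ?_
  -- The hypothesis is positivity under the trace of the block matrix with diagonal `1` and
  -- off-diagonal `X`, `star X`. The choice `w = -vX` minimises the form and leaves `τ (v v*) - τ
  -- (vX (vX)*)`. The factor `c` supplies all conjugates of this difference, hence an operator
  -- inequality.
  have key := hX (fun i => c * v i) (fun j => -∑ i, c * v i * X i j)
  have hv : ∀ j, (toCLM X v) j = ∑ i, v i * X i j := by
    intro j; rw [toCLM_apply_eq_sum]; rfl
  have e1 : ∀ j, ∑ i, c * v i * X i j = c * (toCLM X v) j := by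
    intro j; rw [hv, Finset.mul_sum]; simp only [mul_assoc]
  rw [Finset.sum_comm] at key
  have e2 : ∀ j, ∑ i, τ (c * v i * X i j * star (-∑ i, c * v i * X i j))
      = - τ (c * ((toCLM X v) j * star ((toCLM X v) j)) * star c) := by
    intro j
    rw [← map_sum, ← Finset.sum_mul, e1, star_neg, mul_neg, map_neg, star_mul]
    simp only [mul_assoc]
  simp only [e2] at key
  simp only [e1, star_mul, star_neg, neg_mul, mul_neg, neg_neg] at key
  have e3 : ∀ u : C⋆ᵐᵒᵈ(A, n → A), ∑ i, (τ (c * u i * (star (u i) * star c))).re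
      = (τ (c * (∑ i, u i * star (u i)) * star c)).re := by
    intro u
    rw [Finset.mul_sum, Finset.sum_mul, map_sum, Complex.re_sum]
    simp only [mul_assoc]
  rw [e3, e3, Finset.sum_neg_distrib, Complex.neg_re, ← map_sum, ← Finset.sum_mul,
    ← Finset.mul_sum] at key
  rw [mul_sub, sub_mul, map_sub, Complex.sub_re]
  linarith

end IsFaithfulTracialState

/-- The matrix `(star (r l) * r k)` is `star R * R`, where `R` has the single nonzero row `r`. Its
image is therefore some `star Q * Q`, and the double sum becomes the trace of a sum of squares. -/
lemma isTraceCompletelyPositive_of_completelyPositive (τ : A →ₚ[ℂ] ℂ) (T : A →CP A) :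
    τ.IsTraceCompletelyPositive T.toLinearMap := by
  intro ι _ r u
  classical
  rcases isEmpty_or_nonempty ι with hι | ⟨⟨i₀⟩⟩
  · simp
  let R : CStarMatrix ι ι A := CStarMatrix.ofMatrix fun i j => if i = i₀ then r j else 0
  have hR : ∀ i j, R i j = if i = i₀ then r j else 0 := fun _ _ => rfl
  obtain ⟨Q, hQ⟩ := NonUnitalCStarAlgebra.exists_eq_star_mul_self
    (T.map_cstarMatrix_nonneg (star R * R) (star_mul_self_nonneg R))
  have hT : ∀ l k, T.toLinearMap (star (r l) * r k) = ∑ m, star (Q m l) * Q m k := by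
    intro l k
    have h1 : (star R * R) l k = star (r l) * r k := by
      rw [CStarMatrix.mul_apply, Finset.sum_eq_single i₀]
      · simp [hR, CStarMatrix.star_apply]
      · intro b _ hb; simp [hR, hb]
      · simp
    have h2 := congrArg (fun Z : CStarMatrix ι ι A => Z l k) hQ
    simp only [CStarMatrix.map_apply, h1, CStarMatrix.mul_apply, CStarMatrix.star_apply] at h2
    exact h2
  have h3 : ∑ l, ∑ k, star (u l) * T.toLinearMap (star (r l) * r k) * u k
      = ∑ m, star (∑ l, Q m l * u l) * ∑ k, Q m k * u k := by
    simp only [hT, star_sum, Finset.sum_mul_sum, star_mul]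
    rw [Finset.sum_comm' (s := Finset.univ) (t := fun _ => Finset.univ) (t' := Finset.univ)
      (s' := fun _ => Finset.univ) (by simp)]
    rw [Finset.sum_comm (s := (Finset.univ : Finset ι)) (t := (Finset.univ : Finset ι))
      (f := fun m l => ∑ k, star (u l) * star (Q m l) * (Q m k * u k))]
    rw [Finset.sum_comm]
    refine Finset.sum_congr rfl fun l _ => ?_
    rw [Finset.sum_comm]
    refine Finset.sum_congr rfl fun k _ => ?_
    simp only [Finset.mul_sum, Finset.sum_mul, mul_assoc]
  simp only [← map_sum]
  rw [h3]
  exact τ.re_nonneg_of_nonneg (Finset.sum_nonneg fun m _ => star_mul_self_nonneg _)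

namespace IsTraceCompletelyPositive

/-- Complete positivity passes to the adjoint for the trace. -/
lemma of_adjoint (h : τ.IsFaithfulTracialState) {T T' : A →ₗ[ℂ] A}
    (hT : τ.IsTraceCompletelyPositive T) (hadj : ∀ x y, τ (T' x * y) = τ (x * T y)) :
    τ.IsTraceCompletelyPositive T' := by
  intro ι _ r u
  -- Moving `T'` across the trace exchanges the roles of `r` and `u`, up to stars, and swaps the two
  -- summation indices.
  have := hT ι (fun i => star (u i)) (fun i => star (r i))
  rw [Finset.sum_comm] at this
  convert this using 4 with l _ k _
  rw [mul_assoc, h.tracial, mul_assoc, hadj, mul_assoc, h.tracial]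
  simp only [star_star, mul_assoc]

/-- A completely positive map `T` with `T 1 ≤ 1` is completely contractive. -/
lemma norm_map_le_one (h : τ.IsFaithfulTracialState) {T : A →ₗ[ℂ] A}
    (hT : τ.IsTraceCompletelyPositive T) (hstar : ∀ x, T (star x) = star (T x)) (h1 : T 1 ≤ 1)
    {n : ℕ} (Y : CStarMatrix (Fin n) (Fin n) A) (hY : ‖Y‖ ≤ 1) : ‖Y.map T‖ ≤ 1 := by
  refine h.cstarMatrix_norm_le_one _ fun v w => ?_
  have hYY : star Y * Y ≤ 1 := by
    refine CStarAlgebra.norm_le_one_iff_of_nonneg (star Y * Y) (star_mul_self_nonneg Y) |>.mp ?_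
    rw [CStarRing.norm_star_mul_self]
    nlinarith [norm_nonneg Y]
  -- With `star D * D = 1 - star Y * Y`, the block matrix `[[1, Y], [star Y, 1]]` equals `star R *
  -- R` for `R = [[1, Y], [0, D]]`. Complete positivity is applied to each row of `R` and the
  -- results are summed.
  obtain ⟨D, hD⟩ := NonUnitalCStarAlgebra.exists_eq_star_mul_self (sub_nonneg.mpr hYY)
  let R : Fin n ⊕ Fin n → Fin n ⊕ Fin n → A := fun m k => Sum.elim
    (fun i => Sum.elim (fun j => if i = j then 1 else 0) (fun j => Y i j) k)
    (fun i => Sum.elim (fun _ => 0) (fun j => D i j) k) m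
  let u : Fin n ⊕ Fin n → A := Sum.elim (fun i => star (v i)) (fun j => star (w j))
  have hsum : 0 ≤ ∑ m, (∑ l, ∑ k, τ (star (u l) * T (star (R m l) * R m k) * u k)).re :=
    Finset.sum_nonneg fun m _ => hT _ (R m) u
  have hre : ∑ m, (∑ l, ∑ k, τ (star (u l) * T (star (R m l) * R m k) * u k)).re
      = (∑ l, ∑ k, τ (star (u l) * T (∑ m, star (R m l) * R m k) * u k)).re := by
    rw [← Complex.re_sum, Finset.sum_comm]
    congr 1
    refine Finset.sum_congr rfl fun l _ => ?_
    rw [Finset.sum_comm]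
    refine Finset.sum_congr rfl fun k _ => ?_
    simp only [map_sum, Finset.mul_sum, Finset.sum_mul]
  rw [hre] at hsum
  have r11 : ∀ i j : Fin n, ∑ m, star (R m (Sum.inl i)) * R m (Sum.inl j)
      = if i = j then 1 else 0 := by
    intro i j
    simp [R, Fintype.sum_sum_type, apply_ite star, eq_comm]
  have r12 : ∀ i j : Fin n, ∑ m, star (R m (Sum.inl i)) * R m (Sum.inr j) = Y i j := by
    intro i j
    simp [R, Fintype.sum_sum_type, apply_ite star, ite_mul]
  have r21 : ∀ i j : Fin n, ∑ m, star (R m (Sum.inr i)) * R m (Sum.inl j) = star (Y j i) := by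
    intro i j
    simp [R, Fintype.sum_sum_type]
  have r22 : ∀ i j : Fin n, ∑ m, star (R m (Sum.inr i)) * R m (Sum.inr j)
      = if i = j then 1 else 0 := by
    intro i j
    have e := congrArg (fun Z : CStarMatrix (Fin n) (Fin n) A => Z i j) hD
    simp only [CStarMatrix.sub_apply, CStarMatrix.one_apply, CStarMatrix.mul_apply,
      CStarMatrix.star_apply] at e
    simp only [R, Fintype.sum_sum_type, Sum.elim_inl, Sum.elim_inr]
    rw [← e]; abel
  simp only [Fintype.sum_sum_type (f := fun _ : Fin n ⊕ Fin n => (_ : ℂ)), r11, r12, r21,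
    r22] at hsum
  have diag : ∀ p : Fin n → A,
      (∑ i, ∑ j, τ (star (star (p i)) * T (if i = j then 1 else 0) * star (p j))).re
        ≤ ∑ i, (τ (p i * star (p i))).re := by
    intro p
    rw [Complex.re_sum]
    refine Finset.sum_le_sum fun i _ => ?_
    rw [Finset.sum_eq_single i (by intro b _ hb; simp [hb.symm]) (by simp)]
    simp only [if_true, star_star]
    refine τ.re_mono ?_
    simpa using! star_left_conjugate_le_conjugate h1 (star (p i))
  have d1 := diag v
  have d2 := diag w
  have cross : (∑ i, ∑ j, τ (star (star (w i)) * T (star (Y j i)) * star (v j))).re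
      = (∑ i, ∑ j, τ (v i * T (Y i j) * star (w j))).re := by
    rw [Finset.sum_comm]
    simp only [Complex.re_sum]
    refine Finset.sum_congr rfl fun i _ => Finset.sum_congr rfl fun j _ => ?_
    rw [← τ.re_star, hstar]
    simp [mul_assoc]
  simp only [u, Sum.elim_inl, Sum.elim_inr, Finset.sum_add_distrib, Complex.add_re] at hsum
  rw [cross] at hsum
  simp only [star_star, CStarMatrix.map_apply] at *
  linarith

end IsTraceCompletelyPositive

end PositiveLinearMap

/-! ### The space `L²`, cutoffs by functional calculus, and adjoints on the algebra -/

namespace PositiveLinearMap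

variable {A : Type*} [CStarAlgebra A] [PartialOrder A] [StarOrderedRing A] {τ : A →ₚ[ℂ] ℂ}

/-- The canonical linear map from `A` to the Hilbert space of the GNS construction. -/
def gnsVec (τ : A →ₚ[ℂ] ℂ) : A →ₗ[ℂ] τ.GNS where
  toFun x := ((τ.toPreGNS x : τ.PreGNS) : UniformSpace.Completion τ.PreGNS)
  map_add' x y := by rw [map_add, UniformSpace.Completion.coe_add]
  map_smul' c x := by rw [map_smul, UniformSpace.Completion.coe_smul]; rfl

lemma inner_gnsVec (x y : A) : inner ℂ (τ.gnsVec x) (τ.gnsVec y) = τ (star x * y) := by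
  change inner ℂ ((τ.toPreGNS x : τ.PreGNS) : UniformSpace.Completion τ.PreGNS)
    ((τ.toPreGNS y : τ.PreGNS) : UniformSpace.Completion τ.PreGNS) = _
  rw [UniformSpace.Completion.inner_coe, preGNS_inner_def]
  rfl

lemma norm_gnsVec_sq (x : A) : ‖τ.gnsVec x‖ ^ 2 = (τ (star x * x)).re := by
  rw [← inner_gnsVec, ← inner_self_eq_norm_sq (𝕜 := ℂ)]
  rfl

lemma denseRange_gnsVec (τ : A →ₚ[ℂ] ℂ) : DenseRange τ.gnsVec :=
  UniformSpace.Completion.denseRange_coe.comp τ.toPreGNS.surjective.denseRange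
    (UniformSpace.Completion.continuous_coe _)

lemma norm_gnsVec_le_of_le {x y : A} (hxy : star x * x ≤ star y * y) :
    ‖τ.gnsVec x‖ ≤ ‖τ.gnsVec y‖ := by
  rw [← sq_le_sq₀ (norm_nonneg _) (norm_nonneg _), norm_gnsVec_sq, norm_gnsVec_sq]
  exact τ.re_mono hxy

lemma exists_clm_of_norm_gnsVec_le {T : A →ₗ[ℂ] A} {C : ℝ}
    (hT : ∀ x, ‖τ.gnsVec (T x)‖ ≤ C * ‖τ.gnsVec x‖) :
    ∃ S : τ.GNS →L[ℂ] τ.GNS, ∀ x, S (τ.gnsVec x) = τ.gnsVec (T x) :=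
  ⟨(τ.gnsVec ∘ₗ T).extendOfNorm τ.gnsVec,
    LinearMap.extendOfNorm_eq τ.denseRange_gnsVec ⟨C, hT⟩⟩

lemma norm_gnsVec_mul_le (a x : A) : ‖τ.gnsVec (a * x)‖ ≤ ‖a‖ * ‖τ.gnsVec x‖ := by
  rw [← sq_le_sq₀ (norm_nonneg _) (by positivity), mul_pow, norm_gnsVec_sq, norm_gnsVec_sq]
  have h1 : star (a * x) * (a * x) ≤ ((‖a‖ ^ 2 : ℝ) : ℂ) • (star x * x) := by
    have h2 : star a * a ≤ algebraMap ℝ A (‖a‖ ^ 2) := by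
      rw [sq, ← CStarRing.norm_star_mul_self]
      exact (IsSelfAdjoint.star_mul_self a).le_algebraMap_norm_self
    have h3 := star_left_conjugate_le_conjugate h2 x
    convert h3 using 1
    · simp [mul_assoc]
    · rw [Complex.coe_smul]
      simp [Algebra.algebraMap_eq_smul_one]
  have h2 := τ.re_mono h1
  rw [map_smul, smul_eq_mul, Complex.re_ofReal_mul] at h2
  exact h2

/-- `τ(p y) ≤ τ(p y')` for `0 ≤ p` and `y ≤ y'`. -/
lemma IsFaithfulTracialState.re_mul_le (h : τ.IsFaithfulTracialState) {p y y' : A} (hp : 0 ≤ p)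
    (hy : y ≤ y') : (τ (p * y)).re ≤ (τ (p * y')).re := by
  obtain ⟨c, rfl⟩ := NonUnitalCStarAlgebra.exists_eq_star_mul_self hp
  rw [mul_assoc, h.tracial, mul_assoc _ c, h.tracial (star c)]
  refine τ.re_mono ?_
  exact star_right_conjugate_le_conjugate hy c

namespace IsFaithfulTracialState

lemma gnsVec_injective (h : τ.IsFaithfulTracialState) : Function.Injective τ.gnsVec := by
  rw [injective_iff_map_eq_zero]
  intro x hx
  refine h.faithful x ?_
  rw [← inner_gnsVec, hx, inner_zero_left]

lemma norm_gnsVec_star (h : τ.IsFaithfulTracialState) (x : A) :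
    ‖τ.gnsVec (star x)‖ = ‖τ.gnsVec x‖ := by
  rw [← sq_eq_sq₀ (norm_nonneg _) (norm_nonneg _), norm_gnsVec_sq, norm_gnsVec_sq, h.tracial,
    star_star]

lemma norm_gnsVec_mul_le_right (h : τ.IsFaithfulTracialState) (x a : A) :
    ‖τ.gnsVec (x * a)‖ ≤ ‖a‖ * ‖τ.gnsVec x‖ := by
  rw [← h.norm_gnsVec_star, star_mul, ← norm_star a, ← h.norm_gnsVec_star x]
  exact norm_gnsVec_mul_le _ _

lemma norm_gnsVec_one (h : τ.IsFaithfulTracialState) : ‖τ.gnsVec 1‖ = 1 := by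
  rw [← sq_eq_sq₀ (norm_nonneg _) zero_le_one, norm_gnsVec_sq, star_one, one_mul, h.map_one]
  simp

lemma norm_gnsVec_le (h : τ.IsFaithfulTracialState) (x : A) : ‖τ.gnsVec x‖ ≤ ‖x‖ := by
  simpa [h.norm_gnsVec_one] using norm_gnsVec_mul_le (τ := τ) x 1

end IsFaithfulTracialState

/-- The positive part of `x` is approximately `h * x` with `0 ≤ h ≤ 1`. -/
lemma exists_posPart_le_mul_add {x : A} (hx : IsSelfAdjoint x) {ε : ℝ} (hε : 0 < ε) :
    ∃ h : A, 0 ≤ h ∧ h ≤ 1 ∧ x⁺ ≤ h * x + algebraMap ℝ A ε := by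
  -- A continuous substitute for the spectral projection of `x` onto the positive half-line: `t⁺ ≤ f
  -- t * t + ε`, the error arising only for `0 < t < ε`.
  let f : ℝ → ℝ := fun t => max 0 (min 1 (t / ε))
  have hf : Continuous f := by fun_prop
  refine ⟨cfc f x, cfc_nonneg fun t _ => le_max_left _ _,
    cfc_le_one _ _ fun t _ => max_le zero_le_one (min_le_left _ _), ?_⟩
  have h1 : cfc f x * x + algebraMap ℝ A ε = cfc (fun t => f t * t + ε) x := by
    rw [cfc_add_const ε (fun t => f t * t) x (by fun_prop) hx,
      cfc_mul f (fun t => t) x (by fun_prop) (by fun_prop), cfc_id' ℝ x]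
  have h2 : x⁺ = cfc (·⁺ : ℝ → ℝ) x := by
    rw [CFC.posPart_def, cfcₙ_eq_cfc]
  rw [h1, h2]
  refine cfc_mono (fun t _ => ?_)
  rcases le_total t 0 with ht | ht
  · have : f t = 0 := max_eq_left ((min_le_right _ _).trans (div_nonpos_of_nonpos_of_nonneg ht hε.le))
    rw [posPart_eq_zero.mpr ht, this]; linarith
  · rw [posPart_eq_self.mpr ht]
    rcases le_total t ε with hte | hte
    · have : 0 ≤ f t * t := mul_nonneg (le_max_left _ _) ht
      linarith
    · have : f t = 1 := by
        have h3 : 1 ≤ t / ε := (one_le_div hε).mpr hte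
        simp [f, h3]
      rw [this]; linarith

/-- Take `a = f b` with `f t = max(1, t)^(-1/2)`, so that `a * b * a` is `b / max(1, b)`. The last
clause is `|f t - 1| ≤ |t - 1|` for `t ≥ 0`; it controls `‖a - 1‖₂` by `‖b - 1‖₂`. The intended `b`
is the image of `1` under a completely positive map. -/
lemma exists_cutoff {b : A} (hb : 0 ≤ b) : ∃ a : A, 0 ≤ a ∧ a ≤ 1 ∧ a * b * a ≤ 1 ∧
    star (a - 1) * (a - 1) ≤ star (b - 1) * (b - 1) := by
  let f : ℝ → ℝ := fun t => (√(max 1 t))⁻¹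
  have hpos : ∀ t : ℝ, 1 ≤ √(max 1 t) := fun t => Real.one_le_sqrt.mpr (le_max_left _ _)
  have hf : Continuous f := by
    refine Continuous.inv₀ (by fun_prop) fun t => ?_
    have := hpos t
    positivity
  have hbs : IsSelfAdjoint b := .of_nonneg hb
  have hsub : ∀ (g : ℝ → ℝ), Continuous g → star (cfc g b - 1) * (cfc g b - 1)
      = cfc (fun t => (g t - 1) * (g t - 1)) b := by
    intro g hg
    have e : cfc g b - 1 = cfc (fun t => g t - 1) b := by
      rw [cfc_sub g (fun _ => 1) b (by fun_prop) (by fun_prop), cfc_const_one ℝ b]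
    have hs : IsSelfAdjoint (cfc (fun t => g t - 1) b) := cfc_predicate _ b
    rw [e, hs.star_eq, ← cfc_mul _ _ b (by fun_prop) (by fun_prop)]
  refine ⟨cfc f b, cfc_nonneg fun t _ => by positivity,
    cfc_le_one _ _ fun t _ => inv_le_one_of_one_le₀ (hpos t), ?_, ?_⟩
  · have h1 : cfc f b * b * cfc f b = cfc (fun t => f t * t * f t) b := by
      rw [cfc_mul (fun t => f t * t) f b (by fun_prop) (by fun_prop),
        cfc_mul f (fun t => t) b (by fun_prop) (by fun_prop), cfc_id' ℝ b]
    rw [h1]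
    refine cfc_le_one _ _ fun t _ => ?_
    have h2 : f t * f t = (max 1 t)⁻¹ := by
      simp only [f]
      rw [← mul_inv, Real.mul_self_sqrt (by positivity)]
    have h3 : f t * t * f t = t * (max 1 t)⁻¹ := by rw [← h2]; ring
    rw [h3, ← div_eq_mul_inv, div_le_one (by positivity)]
    exact le_max_right _ _
  · have e2 := hsub (fun t => t) (by fun_prop)
    rw [cfc_id' ℝ b] at e2
    rw [e2, hsub f hf]
    refine cfc_mono fun t ht => ?_
    rcases le_total t 1 with h1 | h1
    · have : f t = 1 := by simp [f, max_eq_left h1]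
      rw [this]; nlinarith
    · have hs := Real.one_le_sqrt.mpr h1
      have hss := Real.mul_self_sqrt (zero_le_one.trans h1)
      have hft : f t = (√t)⁻¹ := by simp [f, max_eq_right h1]
      have h2 : (√t)⁻¹ ≤ 1 := inv_le_one_of_one_le₀ hs
      -- This is `s + s⁻¹ ≥ 2` for `s = √t`; it yields `1 - s⁻¹ ≤ s - 1 ≤ t - 1`.
      have h3 : 2 - √t ≤ (√t)⁻¹ := by
        rw [← one_div, le_div_iff₀ (by linarith)]
        nlinarith
      rw [hft]
      have h4 : √t ≤ t := by nlinarith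
      have h5 := mul_self_le_mul_self (show 0 ≤ 1 - (√t)⁻¹ by linarith)
        (show 1 - (√t)⁻¹ ≤ t - 1 by linarith)
      linarith

/-- A positive linear map `T` with `τ ∘ T ≤ τ` whose extension `S` to `L²` has an adjoint which
maps the operator interval `[0, 1]` to itself. -/
lemma IsFaithfulTracialState.exists_adjoint_gnsVec_eq (h : τ.IsFaithfulTracialState)
    (hcl : IsClosed (τ.gnsVec '' Set.Icc 0 1)) {T : A →ₗ[ℂ] A} (hpos : ∀ x, 0 ≤ x → 0 ≤ T x)
    (hstar : ∀ x, T (star x) = star (T x)) (hτ : ∀ x, 0 ≤ x → (τ (T x)).re ≤ (τ x).re)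
    {S : τ.GNS →L[ℂ] τ.GNS} (hS : ∀ x, S (τ.gnsVec x) = τ.gnsVec (T x))
    {y : A} (hy : y ∈ Set.Icc 0 1) :
    ∃ z ∈ Set.Icc (0 : A) 1, τ.gnsVec z = S.adjoint (τ.gnsVec y) := by
  by_contra hne
  set ξ : τ.GNS := S.adjoint (τ.gnsVec y) with hξ
  have hconv : Convex ℝ (τ.gnsVec '' Set.Icc 0 1) := by
    have := (convex_Icc (𝕜 := ℝ) (0 : A) 1).is_linear_image (f := τ.gnsVec)
      ⟨map_add _, fun c x => by
        rw [← Complex.coe_smul c x, map_smul, Complex.coe_smul]⟩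
    exact this
  -- If `ξ` were outside the closed convex image of `[0, 1]`, a functional would separate them with
  -- gap `g`. Its representing vector is approximated by some `x` in the algebra, with `δ` chosen so
  -- that the errors at `ξ` and at a vector of norm at most `1` add up to at most `g / 4`.
  obtain ⟨f, u, hfu, huf⟩ := RCLike.geometric_hahn_banach_closed_point (𝕜 := ℂ) hconv hcl hne
  set η := (InnerProductSpace.toDual ℂ τ.GNS).symm f with hη
  have hfη : ∀ v, f v = inner ℂ η v := fun v => by
    rw [hη, InnerProductSpace.toDual_symm_apply]
  set g : ℝ := RCLike.re (f ξ) - u with hg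
  have hg0 : 0 < g := sub_pos.mpr huf
  obtain ⟨x, hx⟩ := τ.denseRange_gnsVec.exists_dist_lt η
    (show 0 < g / (4 * (1 + ‖ξ‖)) by positivity)
  set δ := g / (4 * (1 + ‖ξ‖)) with hδ
  have hδξ : δ * (1 + ‖ξ‖) = g / 4 := by rw [hδ]; field_simp
  have hdiff : ∀ v, |(inner ℂ η v).re - (inner ℂ (τ.gnsVec x) v).re| ≤ δ * ‖v‖ := by
    intro v
    rw [← Complex.sub_re, ← inner_sub_left]
    refine (Complex.abs_re_le_norm _).trans ((norm_inner_le_norm _ _).trans ?_)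
    rw [← dist_eq_norm]
    gcongr
  -- Only the self-adjoint part of `x` matters: real parts of pairings are taken with self-adjoint
  -- elements and with `ξ`, where `y` is self-adjoint and `T` preserves stars.
  set a : A := (1 / 2 : ℂ) • (x + star x) with ha
  have hasa : IsSelfAdjoint a := by
    have h12 : (starRingEnd ℂ) (1 / 2) = 1 / 2 := Complex.conj_ofReal (1 / 2) |> fun e => by
      simpa using e
    rw [IsSelfAdjoint, ha, star_smul, star_add, star_star, add_comm, RCLike.star_def, h12]
  have hhalf : ∀ p q : ℂ, p.re = q.re → ((1 / 2 : ℂ) * (p + q)).re = p.re := by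
    intro p q hpq
    have : (1 / 2 : ℂ) = ((1 / 2 : ℝ) : ℂ) := by simp
    rw [this, Complex.re_ofReal_mul, Complex.add_re, ← hpq]; ring
  have hleft : ∀ b, IsSelfAdjoint b → (inner ℂ (τ.gnsVec x) (τ.gnsVec b)).re = (τ (b * a)).re := by
    intro b hb
    have e1 : (τ (b * x)).re = (τ (b * star x)).re := by
      rw [← τ.re_star (b * x), star_mul, hb.star_eq, h.tracial]
    rw [inner_gnsVec, h.tracial, ha, mul_smul_comm, map_smul, mul_add, map_add, smul_eq_mul,
      hhalf _ _ e1, e1]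
  have hright : (inner ℂ (τ.gnsVec x) ξ).re = (τ (T a * y)).re := by
    have hys : IsSelfAdjoint y := .of_nonneg hy.1
    have e1 : (τ (T x * y)).re = (τ (T (star x) * y)).re := by
      rw [← τ.re_star (T x * y), star_mul, hys.star_eq, h.tracial, hstar]
    rw [hξ, ContinuousLinearMap.adjoint_inner_right, hS, inner_gnsVec, ← hstar, ha, map_smul,
      map_add, smul_mul_assoc, add_mul, map_smul, map_add, smul_eq_mul, hhalf _ _ e1, e1]
  obtain ⟨k, hk0, hk1, hk⟩ := exists_posPart_le_mul_add hasa (show 0 < g / 4 by positivity)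
  have hkn : ‖τ.gnsVec k‖ ≤ 1 :=
    (h.norm_gnsVec_le k).trans ((CStarAlgebra.norm_le_one_iff_of_nonneg k hk0).mpr hk1)
  -- The contradiction is the chain `τ (T a * y) ≤ τ (T a⁺ * y) ≤ τ (T a⁺) ≤ τ a⁺ ≤ τ (k * a) + g /
  -- 4` of real parts. Its ends are approximately the functional at `ξ` and at the point `k` of `[0,
  -- 1]`, and the total error is at most `g / 2`.
  have i1 : (τ (T a * y)).re ≤ (τ (T a⁺ * y)).re := by
    have : T a ≤ T a⁺ := by
      rw [← sub_nonneg, ← map_sub]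
      refine hpos _ ?_
      rw [sub_nonneg]
      nth_rewrite 1 [← CFC.posPart_sub_negPart a hasa]
      exact sub_le_self _ (CFC.negPart_nonneg a)
    rw [h.tracial, h.tracial (T a⁺)]
    exact h.re_mul_le hy.1 this
  have i2 : (τ (T a⁺ * y)).re ≤ (τ (T a⁺)).re := by
    simpa using h.re_mul_le (hpos _ (CFC.posPart_nonneg a)) hy.2
  have i3 := hτ _ (CFC.posPart_nonneg a)
  have i4 : (τ a⁺).re ≤ (τ (k * a)).re + g / 4 := by
    have := τ.re_mono hk
    rw [map_add, Complex.add_re, Algebra.algebraMap_eq_smul_one, ← Complex.coe_smul, map_smul,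
      h.map_one] at this
    simpa using this
  have i5 := hfu _ ⟨k, ⟨hk0, hk1⟩, rfl⟩
  rw [hfη] at i5
  rw [hfη] at hg
  have i6 := abs_le.mp (hdiff (τ.gnsVec k))
  have i7 := abs_le.mp (hdiff ξ)
  rw [hleft k (.of_nonneg hk0)] at i6
  rw [hright] at i7
  have i8 : δ * ‖τ.gnsVec k‖ ≤ δ := mul_le_of_le_one_right (by positivity) hkn
  simp only [RCLike.re_eq_complex_re] at i5 hg
  nlinarith [i6.1, i6.2, i7.1, i7.2]

/-- A positive linear map `T` with `τ ∘ T ≤ τ` and extending to `L²` has an adjoint on `A`. -/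
lemma IsFaithfulTracialState.exists_adjoint (h : τ.IsFaithfulTracialState)
    (hcl : IsClosed (τ.gnsVec '' Set.Icc 0 1)) {T : A →ₗ[ℂ] A} (hpos : ∀ x, 0 ≤ x → 0 ≤ T x)
    (hstar : ∀ x, T (star x) = star (T x)) (hτ : ∀ x, 0 ≤ x → (τ (T x)).re ≤ (τ x).re)
    {S : τ.GNS →L[ℂ] τ.GNS} (hS : ∀ x, S (τ.gnsVec x) = τ.gnsVec (T x)) :
    ∃ T' : A →ₗ[ℂ] A, (∀ x, S.adjoint (τ.gnsVec x) = τ.gnsVec (T' x)) ∧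
      (∀ x, T' (star x) = star (T' x)) ∧ T' 1 ≤ 1 ∧ ∀ x y, τ (T' x * y) = τ (x * T y) := by
  have key := fun y hy => h.exists_adjoint_gnsVec_eq hcl hpos hstar hτ hS (y := y) hy
  have hpos' : ∀ y, 0 ≤ y → ∃ z, 0 ≤ z ∧ τ.gnsVec z = S.adjoint (τ.gnsVec y) := by
    intro y hy
    rcases eq_or_ne y 0 with rfl | hy0
    · exact ⟨0, le_rfl, by simp⟩
    have hn : 0 < ‖y‖ := norm_pos_iff.mpr hy0
    obtain ⟨z, hz, hzS⟩ := key (‖y‖⁻¹ • y) ⟨smul_nonneg (by positivity) hy, by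
      rw [← CStarAlgebra.norm_le_one_iff_of_nonneg _ (smul_nonneg (by positivity) hy), norm_smul,
        norm_inv, norm_norm, inv_mul_cancel₀ hn.ne']⟩
    refine ⟨‖y‖ • z, smul_nonneg hn.le hz.1, ?_⟩
    rw [← Complex.coe_smul, map_smul, hzS, ← Complex.coe_smul, map_smul, map_smul, smul_smul,
      ← Complex.ofReal_mul, mul_inv_cancel₀ hn.ne', Complex.ofReal_one, one_smul]
  have hrange : ∀ y, S.adjoint (τ.gnsVec y) ∈ LinearMap.range τ.gnsVec := by
    intro y
    -- Rescaling into `[0, 1]` handles positive elements, and these span the algebra.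
    have hy : y ∈ Submodule.span ℂ {a : A | 0 ≤ a} := by
      rw [CStarAlgebra.span_nonneg]; trivial
    induction hy using Submodule.span_induction with
    | mem x hx => obtain ⟨z, -, hz⟩ := hpos' x hx; exact ⟨z, hz⟩
    | zero => simp
    | add x y _ _ hx hy => rw [map_add, map_add]; exact add_mem hx hy
    | smul c x _ hx => rw [map_smul, map_smul]; exact Submodule.smul_mem _ _ hx
  let T' : A →ₗ[ℂ] A := (LinearEquiv.ofInjective τ.gnsVec h.gnsVec_injective).symm.toLinearMap ∘ₗ
    LinearMap.codRestrict _ (S.adjoint.toLinearMap ∘ₗ τ.gnsVec) hrange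
  have hT' : ∀ x, S.adjoint (τ.gnsVec x) = τ.gnsVec (T' x) := by
    intro x
    have := LinearEquiv.apply_symm_apply (LinearEquiv.ofInjective τ.gnsVec h.gnsVec_injective)
      (LinearMap.codRestrict _ (S.adjoint.toLinearMap ∘ₗ τ.gnsVec) hrange x)
    exact (congrArg Subtype.val this).symm
  have hpos'' : ∀ x, 0 ≤ x → 0 ≤ T' x := by
    intro x hx
    obtain ⟨z, hz, hzS⟩ := hpos' x hx
    rw [hT'] at hzS
    rwa [← h.gnsVec_injective hzS]
  have hst : ∀ x, T' (star x) = star (T' x) := fun x => map_star (PositiveLinearMap.mk₀ T' hpos'') x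
  refine ⟨T', hT', hst, ?_, fun x y => ?_⟩
  · obtain ⟨z, hz, hzS⟩ := key 1 ⟨zero_le_one, le_rfl⟩
    rw [hT'] at hzS
    rw [← h.gnsVec_injective hzS]
    exact hz.2
  · have := ContinuousLinearMap.adjoint_inner_left S (τ.gnsVec y) (τ.gnsVec (star x))
    rw [hT', hS, inner_gnsVec, inner_gnsVec, hst, star_star, star_star] at this
    exact this

end PositiveLinearMap

/-! ### The diagonal action on `ℓ²(ℕ, H)` -/

section Diagonal

variable {E : Type*} [NormedAddCommGroup E]

lemma lp.norm_sq_eq_tsum (ξ : lp (fun _ : ℕ => E) 2) : ‖ξ‖ ^ 2 = ∑' n, ‖ξ n‖ ^ 2 := by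
  have := lp.norm_rpow_eq_tsum (p := 2) (by simp) ξ
  simpa using this

lemma lp.summable_norm_sq (ξ : lp (fun _ : ℕ => E) 2) : Summable fun n => ‖ξ n‖ ^ 2 := by
  have := (lp.memℓp ξ).summable (by simp)
  simpa using this

lemma memℓp_two_of_summable {ξ : ℕ → E} (h : Summable fun n => ‖ξ n‖ ^ 2) :
    Memℓp ξ 2 := by
  refine memℓp_gen ?_
  simpa using h

variable {H : Type*} [NormedAddCommGroup H] [InnerProductSpace ℂ H]

/-- The diagonal action of a bounded operator on `ℓ²(ℕ, H)`. -/
def ContinuousLinearMap.diagonal (x : H →L[ℂ] H) :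
    lp (fun _ : ℕ => H) 2 →L[ℂ] lp (fun _ : ℕ => H) 2 :=
  have hb : ∀ (ξ : lp (fun _ : ℕ => H) 2) (n : ℕ), ‖x (ξ n)‖ ^ 2 ≤ ‖x‖ ^ 2 * ‖ξ n‖ ^ 2 := by
    intro ξ n
    rw [← mul_pow]
    gcongr
    exact x.le_opNorm _
  have hs : ∀ ξ : lp (fun _ : ℕ => H) 2, Summable fun n => ‖x (ξ n)‖ ^ 2 := fun ξ =>
    ((lp.summable_norm_sq ξ).mul_left (‖x‖ ^ 2)).of_nonneg_of_le (fun _ => by positivity) (hb ξ)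
  LinearMap.mkContinuous
    { toFun := fun ξ => ⟨fun n => x (ξ n), memℓp_two_of_summable (hs ξ)⟩
      map_add' := fun ξ η => by ext n; simp; rfl
      map_smul' := fun c ξ => by ext n; simp } ‖x‖ fun ξ => by
    rw [← sq_le_sq₀ (norm_nonneg _) (by positivity), mul_pow, lp.norm_sq_eq_tsum,
      lp.norm_sq_eq_tsum, ← tsum_mul_left]
    exact (hs ξ).tsum_le_tsum (hb ξ) ((lp.summable_norm_sq ξ).mul_left _)

@[simp]
lemma ContinuousLinearMap.diagonal_apply (x : H →L[ℂ] H) (ξ : lp (fun _ : ℕ => H) 2) (n : ℕ) :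
    x.diagonal ξ n = x (ξ n) := rfl

lemma ContinuousLinearMap.diagonal_mul (x y : H →L[ℂ] H) :
    (x * y).diagonal = x.diagonal * y.diagonal := by
  ext ξ n; rfl

lemma ContinuousLinearMap.diagonal_one : (1 : H →L[ℂ] H).diagonal = 1 := by
  ext ξ n; rfl

lemma ContinuousLinearMap.inner_diagonal_left [CompleteSpace H] (x : H →L[ℂ] H)
    (ξ η : lp (fun _ : ℕ => H) 2) :
    inner ℂ (x.diagonal ξ) η = inner ℂ ξ ((star x).diagonal η) := by
  rw [lp.inner_eq_tsum, lp.inner_eq_tsum]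
  refine tsum_congr fun n => ?_
  simp [ContinuousLinearMap.star_eq_adjoint, ContinuousLinearMap.adjoint_inner_right]

end Diagonal

/-! ### Ultraweak functionals and weak compactness of bounded sets -/

namespace VonNeumannAlgebra

variable {H : Type*} [NormedAddCommGroup H] [InnerProductSpace ℂ H] [CompleteSpace H]
  (M : VonNeumannAlgebra H)

lemma ultraweakFunctional_eq_inner (ξ η : lp (fun _ : ℕ => H) 2) (x : M) :
    M.ultraweakFunctional ξ η x = inner ℂ η ((x : H →L[ℂ] H).diagonal ξ) := by
  rw [lp.inner_eq_tsum]
  rfl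

/-- The ultraweak functionals as linear functionals. -/
def ultraweakFunctionalₗ (p : lp (fun _ : ℕ => H) 2 × lp (fun _ : ℕ => H) 2) : M →ₗ[ℂ] ℂ where
  toFun := M.ultraweakFunctional p.1 p.2
  map_add' x y := by
    simp only [ultraweakFunctional_eq_inner, ← inner_add_right]
    congr 1
  map_smul' c x := by
    simp only [ultraweakFunctional_eq_inner, RingHom.id_apply, smul_eq_mul, ← inner_smul_right]
    congr 1

lemma continuous_ultraweakFunctional (ξ η : lp (fun _ : ℕ => H) 2) :
    Continuous[M.ultraweakTopology, inferInstance] (M.ultraweakFunctional ξ η) :=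
  continuous_iff_le_induced.mpr (iInf_le _ (ξ, η))

lemma exists_hasSum_eq_ultraweakFunctional {ι : Type*} (e : ℕ ≃ ι) {ξ η : ι → H}
    (hξ : Summable fun i => ‖ξ i‖ ^ 2) (hη : Summable fun i => ‖η i‖ ^ 2) :
    ∃ p : lp (fun _ : ℕ => H) 2 × lp (fun _ : ℕ => H) 2, ∀ x : M,
      HasSum (fun i => inner ℂ (η i) ((x : H →L[ℂ] H) (ξ i))) (M.ultraweakFunctional p.1 p.2 x) := by
  let a : lp (fun _ : ℕ => H) 2 :=
    ⟨fun n => ξ (e n), memℓp_two_of_summable (e.summable_iff.mpr hξ)⟩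
  let b : lp (fun _ : ℕ => H) 2 :=
    ⟨fun n => η (e n), memℓp_two_of_summable (e.summable_iff.mpr hη)⟩
  refine ⟨(a, b), fun x => ?_⟩
  rw [ultraweakFunctional_eq_inner, ← e.hasSum_iff]
  exact lp.hasSum_inner b ((x : H →L[ℂ] H).diagonal a)

/-- A functional which is ultraweakly continuous is of the form `x ↦ ∑ₙ ⟨x ξₙ, ηₙ⟩`. -/
lemma exists_eq_ultraweakFunctional {φ : M →ₗ[ℂ] ℂ}
    (hφ : Continuous[M.ultraweakTopology, inferInstance] φ) :
    ∃ p : lp (fun _ : ℕ => H) 2 × lp (fun _ : ℕ => H) 2, ∀ x, φ x = M.ultraweakFunctional p.1 p.2 x := by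
  have hspan := (LinearMap.mem_span_iff_continuous (f := M.ultraweakFunctionalₗ) φ).mpr hφ
  clear hφ
  induction hspan using Submodule.span_induction with
  | mem φ h => obtain ⟨p, rfl⟩ := h; exact ⟨p, fun _ => rfl⟩
  | zero => exact ⟨0, fun x => by simp [ultraweakFunctional]⟩
  | smul c φ _ h =>
    obtain ⟨p, hp⟩ := h
    refine ⟨(c • p.1, p.2), fun x => ?_⟩
    rw [LinearMap.smul_apply, hp, ultraweakFunctional_eq_inner, ultraweakFunctional_eq_inner,
      map_smul, inner_smul_right, smul_eq_mul]
  | add φ ψ _ _ h h' =>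
    obtain ⟨p, hp⟩ := h
    obtain ⟨q, hq⟩ := h'
    -- The sum of two such functionals is again one: the sequences are concatenated along `ℕ ⊕ ℕ ≃
    -- ℕ`.
    obtain ⟨r, hr⟩ := M.exists_hasSum_eq_ultraweakFunctional Equiv.natSumNatEquivNat.symm
      (ξ := Sum.elim p.1 q.1) (η := Sum.elim p.2 q.2)
      (Summable.sum _ (lp.summable_norm_sq p.1) (lp.summable_norm_sq q.1))
      (Summable.sum _ (lp.summable_norm_sq p.2) (lp.summable_norm_sq q.2))
    refine ⟨r, fun x => ((hr x).unique ?_).symm⟩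
    rw [LinearMap.add_apply, hp, hq, ultraweakFunctional_eq_inner, ultraweakFunctional_eq_inner]
    exact HasSum.sum (lp.hasSum_inner p.2 ((x : H →L[ℂ] H).diagonal p.1))
      (lp.hasSum_inner q.2 ((x : H →L[ℂ] H).diagonal q.1))

/-- Bounded families in `M` converge weakly along ultrafilters. -/
lemma exists_tendsto_inner_of_bounded {α : Type*} (f : Ultrafilter α) (x : α → M) {C : ℝ}
    (hx : ∀ a, ‖x a‖ ≤ C) :
    ∃ y : M, ∀ v w : H, Filter.Tendsto (fun a => inner ℂ w ((x a : H →L[ℂ] H) v)) f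
      (𝓝 (inner ℂ w ((y : H →L[ℂ] H) v))) := by
  have hb : ∀ a (v w : H), ‖inner ℂ ((x a : H →L[ℂ] H) v) w‖ ≤ C * ‖v‖ * ‖w‖ := by
    intro a v w
    refine (norm_inner_le_norm _ _).trans ?_
    gcongr
    refine ((x a : H →L[ℂ] H).le_opNorm v).trans ?_
    gcongr
    exact hx a
  have hlim : ∀ v w : H, ∃ l : ℂ, ‖l‖ ≤ C * ‖v‖ * ‖w‖ ∧
      Filter.Tendsto (fun a => inner ℂ ((x a : H →L[ℂ] H) v) w) f (𝓝 l) := by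
    intro v w
    have hc := isCompact_closedBall (0 : ℂ) (C * ‖v‖ * ‖w‖)
    obtain ⟨l, hl, hfl⟩ := isCompact_iff_ultrafilter_le_nhds.mp hc
      (f.map fun a => inner ℂ ((x a : H →L[ℂ] H) v) w) (by
        rw [Filter.le_principal_iff, Ultrafilter.mem_coe, Ultrafilter.mem_map]
        exact Filter.Eventually.of_forall fun a => by
          simpa only [mem_closedBall_zero_iff] using hb a v w)
    exact ⟨l, by simpa using hl, hfl⟩
  choose B hBn hB using hlim
  have hC : ∀ v w : H, ‖B v w‖ ≤ C * ‖v‖ * ‖w‖ := hBn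
  let B' : H →ₗ⋆[ℂ] H →ₗ[ℂ] ℂ := LinearMap.mk₂'ₛₗ (starRingEnd ℂ) (RingHom.id ℂ) B
    (fun v₁ v₂ w => tendsto_nhds_unique (hB _ _) (by
      simpa only [map_add, inner_add_left] using (hB v₁ w).add (hB v₂ w)))
    (fun c v w => tendsto_nhds_unique (hB _ _) (by
      simpa only [map_smul, inner_smul_left, smul_eq_mul] using (hB v w).const_mul (starRingEnd ℂ c)))
    (fun v w₁ w₂ => tendsto_nhds_unique (hB _ _) (by
      simpa only [inner_add_right] using (hB v w₁).add (hB v w₂)))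
    (fun c v w => tendsto_nhds_unique (hB _ _) (by
      simpa only [inner_smul_right, smul_eq_mul, RingHom.id_apply] using (hB v w).const_mul c))
  let y := InnerProductSpace.continuousLinearMapOfBilin (B'.mkContinuous₂ C hC)
  have hy : ∀ v w, inner ℂ (y v) w = B v w := fun v w =>
    InnerProductSpace.continuousLinearMapOfBilin_apply _ v w
  have hty : ∀ v w : H, Filter.Tendsto (fun a => inner ℂ ((x a : H →L[ℂ] H) v) w) f
      (𝓝 (inner ℂ (y v) w)) := fun v w => by rw [hy]; exact hB v w
  -- Commuting with every element of the commutant survives weak limits, so the double commutant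
  -- property puts `y` in `M`.
  have hmem : y ∈ M := by
    rw [← SetLike.mem_coe, ← M.centralizer_centralizer, Set.mem_centralizer_iff]
    intro m hm
    refine ContinuousLinearMap.ext fun v => ext_inner_right ℂ fun w => ?_
    rw [mul_apply_eq_comp, mul_apply_eq_comp]
    refine tendsto_nhds_unique ?_ (hty (m v) w)
    rw [← ContinuousLinearMap.adjoint_inner_right]
    refine (hty v _).congr fun a => ?_
    have := DFunLike.congr_fun (Set.mem_centralizer_iff.mp hm _ (x a).2) v
    rw [mul_apply_eq_comp, mul_apply_eq_comp] at this
    rw [ContinuousLinearMap.adjoint_inner_right, this]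
  refine ⟨⟨y, hmem⟩, fun v w => ?_⟩
  have := (Complex.continuous_conj.tendsto _).comp (hty v w)
  simpa only [Function.comp_def, inner_conj_symm] using this

/-- On bounded sets weak operator convergence implies ultraweak convergence, by dominated
convergence of the defining series. -/
lemma tendsto_ultraweakFunctional {α : Type*} {f : Filter α} {x : α → M} {C : ℝ}
    (hx : ∀ a, ‖x a‖ ≤ C) {y : M}
    (hy : ∀ v w : H, Filter.Tendsto (fun a => inner ℂ w ((x a : H →L[ℂ] H) v)) f
      (𝓝 (inner ℂ w ((y : H →L[ℂ] H) v)))) (ξ η : lp (fun _ : ℕ => H) 2) :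
    Filter.Tendsto (fun a => M.ultraweakFunctional ξ η (x a)) f
      (𝓝 (M.ultraweakFunctional ξ η y)) := by
  refine tendsto_tsum_of_dominated_convergence
    (bound := fun n => C * (‖ξ n‖ ^ 2 + ‖η n‖ ^ 2))
    (((lp.summable_norm_sq ξ).add (lp.summable_norm_sq η)).mul_left C) (fun n => hy _ _)
    (Filter.Eventually.of_forall fun a n => ?_)
  refine (norm_inner_le_norm _ _).trans ?_
  have h1 : ‖(x a : H →L[ℂ] H) (ξ n)‖ ≤ C * ‖ξ n‖ :=
    ((x a : H →L[ℂ] H).le_opNorm _).trans (by gcongr; exact hx a)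
  have hC : 0 ≤ C := (norm_nonneg _).trans (hx a)
  calc ‖η n‖ * ‖(x a : H →L[ℂ] H) (ξ n)‖ ≤ ‖η n‖ * (C * ‖ξ n‖) := by gcongr
    _ = C * (‖ξ n‖ * ‖η n‖) := by ring
    _ ≤ C * (‖ξ n‖ ^ 2 + ‖η n‖ ^ 2) := by
      gcongr
      nlinarith [sq_nonneg (‖ξ n‖ - ‖η n‖), sq_nonneg (‖ξ n‖), sq_nonneg (‖η n‖)]

lemma nonneg_iff_inner (x : M) : 0 ≤ x ↔ ∀ v : H, 0 ≤ inner ℂ v ((x : H →L[ℂ] H) v) := by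
  change (0 : H →L[ℂ] H) ≤ x ↔ _
  rw [ContinuousLinearMap.nonneg_iff_isPositive]
  refine ⟨fun h v => h.inner_nonneg_right v, fun h => ?_⟩
  rw [ContinuousLinearMap.isPositive_iff_complex]
  intro v
  have hv := h v
  rw [← inner_conj_symm, ← RCLike.star_def, star_nonneg_iff] at hv
  obtain ⟨h1, h2⟩ := Complex.nonneg_iff.mp hv
  exact ⟨Complex.ext rfl h2, h1⟩

lemma nonneg_of_tendsto_inner {α : Type*} {f : Filter α} [f.NeBot] {x : α → M} {y : M}
    (hx : ∀ a, 0 ≤ x a)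
    (hy : ∀ v w : H, Filter.Tendsto (fun a => inner ℂ w ((x a : H →L[ℂ] H) v)) f
      (𝓝 (inner ℂ w ((y : H →L[ℂ] H) v)))) : 0 ≤ y := by
  rw [nonneg_iff_inner]
  exact fun v => ge_of_tendsto' (hy v v) fun a => (M.nonneg_iff_inner _).mp (hx a) v

end VonNeumannAlgebra

/-! ### Square roots and intertwiners of Hilbert space representations -/

section Hilbert

variable {E G : Type*} [NormedAddCommGroup E] [InnerProductSpace ℂ E] [CompleteSpace E]

lemma ContinuousLinearMap.exists_sqrt {B : E →L[ℂ] E} (hB : 0 ≤ B) :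
    ∃ R : E →L[ℂ] E, IsSelfAdjoint R ∧ R * R = B ∧ ∀ D, Commute B D → Commute R D :=
  ⟨CFC.sqrt B, (CFC.sqrt_nonneg B).isSelfAdjoint, CFC.sqrt_mul_sqrt_self B hB,
    fun _ hD => hD.cfcₙ_nnreal _⟩

variable [NormedAddCommGroup G] [InnerProductSpace ℂ G] [CompleteSpace G]

/-- The map `e x ↦ g x` extends by continuity to the closure of the range of `e`, and by zero on the
orthogonal complement. -/
lemma LinearMap.exists_clm_of_norm_le {V : Type*} [AddCommGroup V] [Module ℂ V] (e : V →ₗ[ℂ] E)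
    (g : V →ₗ[ℂ] G) (hle : ∀ x, ‖g x‖ ≤ ‖e x‖) :
    ∃ W : E →L[ℂ] G, (∀ x, W (e x) = g x) ∧
      ∀ v ∈ (LinearMap.range e).topologicalClosureᗮ, W v = 0 := by
  set K₀ : Submodule ℂ E := (LinearMap.range e).topologicalClosure
  have : CompleteSpace K₀ := (Submodule.isClosed_topologicalClosure _).completeSpace_coe
  let e' : V →ₗ[ℂ] K₀ := LinearMap.codRestrict K₀ e fun x =>
    Submodule.le_topologicalClosure _ (LinearMap.mem_range_self e x)
  have hdense : DenseRange e' := by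
    intro v
    rw [closure_subtype]
    have hv : (v : E) ∈ closure (LinearMap.range e : Set E) := v.2
    convert hv using 2
    ext w
    simp only [Set.mem_image, Set.mem_range, SetLike.mem_coe, LinearMap.mem_range]
    constructor
    · rintro ⟨_, ⟨x, rfl⟩, rfl⟩; exact ⟨x, rfl⟩
    · rintro ⟨x, rfl⟩; exact ⟨e' x, ⟨x, rfl⟩, rfl⟩
  have hbound : ∃ C : ℝ, ∀ x, ‖g x‖ ≤ C * ‖e' x‖ :=
    ⟨1, fun x => by rw [one_mul]; exact hle x⟩
  refine ⟨g.extendOfNorm e' ∘L K₀.orthogonalProjectionOnto, fun x => ?_, fun v hv => ?_⟩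
  · have : K₀.orthogonalProjectionOnto (e x) = e' x :=
      Submodule.orthogonalProjectionOnto_mem_subspace_eq_self (e' x)
    rw [ContinuousLinearMap.comp_apply, this, LinearMap.extendOfNorm_eq hdense hbound]
  · rw [ContinuousLinearMap.comp_apply,
      Submodule.orthogonalProjectionOnto_apply_of_mem_orthogonal hv, map_zero]

/-- Comparison of cyclic representations: if `‖g x‖ ≤ ‖e x‖` then `e x ↦ g x` extends to a bounded
map which intertwines the two representations. -/
lemma exists_intertwiner_of_norm_le {A : Type*} [NonUnitalRing A] [StarRing A] [Module ℂ A]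
    (e : A →ₗ[ℂ] E) (g : A →ₗ[ℂ] G) (hle : ∀ x, ‖g x‖ ≤ ‖e x‖) (D : A → E →L[ℂ] E)
    (P : A → G →L[ℂ] G) (hD : ∀ x y, D x (e y) = e (x * y)) (hP : ∀ x y, P x (g y) = g (x * y))
    (hstar : ∀ x v w, inner ℂ (D x v) w = inner ℂ v (D (star x) w)) :
    ∃ W : E →L[ℂ] G, (∀ x, W (e x) = g x) ∧ ∀ x v, W (D x v) = P x (W v) := by
  obtain ⟨W, hW, hWperp⟩ := e.exists_clm_of_norm_le g hle
  set K₀ : Submodule ℂ E := (LinearMap.range e).topologicalClosure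
  have : CompleteSpace K₀ := (Submodule.isClosed_topologicalClosure _).completeSpace_coe
  -- The closed range is invariant under every `D x`; since the adjoint of `D x` is `D (star x)`, so
  -- is its complement, on which `W` vanishes.
  have hinv : ∀ x, ∀ v ∈ K₀, D x v ∈ K₀ := by
    intro x v hv
    refine map_mem_closure (D x).continuous hv ?_
    rintro _ ⟨y, rfl⟩
    exact ⟨x * y, (hD x y).symm⟩
  have hperp : ∀ x, ∀ v ∈ K₀ᗮ, D x v ∈ K₀ᗮ := by
    intro x v hv
    rw [Submodule.mem_orthogonal] at hv ⊢
    intro k hk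
    have := hv _ (hinv (star x) k hk)
    rwa [hstar, star_star] at this
  refine ⟨W, hW, fun x v => ?_⟩
  obtain ⟨v₁, hv₁, v₂, hv₂, rfl⟩ := K₀.exists_add_mem_mem_orthogonal v
  have h1 : W (D x v₁) = P x (W v₁) := by
    have hcl : IsClosed {w | W (D x w) = P x (W w)} :=
      isClosed_eq (W.continuous.comp (D x).continuous) ((P x).continuous.comp W.continuous)
    refine closure_minimal ?_ hcl hv₁
    rintro _ ⟨y, rfl⟩
    change W (D x (e y)) = P x (W (e y))
    rw [hD, hW, hW, hP]
  have h2 : W (D x v₂) = 0 := hWperp _ (hperp x v₂ hv₂)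
  rw [map_add, map_add, h1, h2, add_zero, map_add, hWperp v₂ hv₂, add_zero]

end Hilbert

/-! ### The trace as a vector functional, and closedness of `[0, 1]` in `L²` -/

namespace VonNeumannAlgebra

variable {H : Type*} [NormedAddCommGroup H] [InnerProductSpace ℂ H] [CompleteSpace H]
  {M : VonNeumannAlgebra H} {τ : M →ₚ[ℂ] ℂ}

namespace IsFaithfulNormalTrace

lemma isFaithfulTracialState (hτ : M.IsFaithfulNormalTrace τ) : τ.IsFaithfulTracialState :=
  ⟨hτ.map_one, hτ.tracial, hτ.faithful⟩

/-- A normal trace is dominated by a vector functional of the diagonal action on `ℓ²(ℕ, H)`. -/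
lemma exists_norm_gnsVec_le_norm_diagonal (hτ : M.IsFaithfulNormalTrace τ) :
    ∃ κ : lp (fun _ : ℕ => H) 2, ∀ x : M, ‖τ.gnsVec x‖ ≤ ‖(x : H →L[ℂ] H).diagonal κ‖ := by
  obtain ⟨⟨ξ, η⟩, hp⟩ := M.exists_eq_ultraweakFunctional (φ := (τ : M →ₗ[ℂ] ℂ)) hτ.normal
  -- Polarization: `Re ⟨Dη, Dξ⟩ = ‖D((ξ + η)/2)‖² - ‖D((ξ - η)/2)‖²`, and the negative term is
  -- dropped.
  refine ⟨(1 / 2 : ℂ) • (ξ + η), fun x => ?_⟩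
  set D := (x : H →L[ℂ] H).diagonal
  have h1 : (τ (star x * x)).re = (inner ℂ (D η) (D ξ)).re := by
    have h2 : τ (star x * x) = _ := hp (star x * x)
    rw [h2, ultraweakFunctional_eq_inner]
    change (inner ℂ η (((star (x : H →L[ℂ] H)) * x : H →L[ℂ] H).diagonal ξ)).re = _
    rw [ContinuousLinearMap.inner_diagonal_left, ContinuousLinearMap.diagonal_mul]
    rfl
  rw [← sq_le_sq₀ (norm_nonneg _) (norm_nonneg _), PositiveLinearMap.norm_gnsVec_sq, h1, map_smul,
    map_add, norm_smul, mul_pow]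
  have h3 := norm_add_sq (𝕜 := ℂ) (D η) (D ξ)
  have h4 := norm_sub_sq (𝕜 := ℂ) (D η) (D ξ)
  have h5 := sq_nonneg ‖D η - D ξ‖
  rw [add_comm (D ξ)]
  have h6 : ‖(1 / 2 : ℂ)‖ ^ 2 = 1 / 4 := by norm_num
  rw [h6]
  simp only [RCLike.re_eq_complex_re] at h3 h4
  linarith

/-- `ℓ²(ℕ, H)` maps to `L²(M, τ)` by a bounded `M`-linear map. -/
lemma exists_intertwiner (hτ : M.IsFaithfulNormalTrace τ) :
    ∃ (κ : lp (fun _ : ℕ => H) 2) (W : lp (fun _ : ℕ => H) 2 →L[ℂ] τ.GNS),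
      (∀ x : M, W ((x : H →L[ℂ] H).diagonal κ) = τ.gnsVec x) ∧
      ∀ (x : M) v, W ((x : H →L[ℂ] H).diagonal v) = τ.gnsNonUnitalStarAlgHom x (W v) := by
  obtain ⟨κ, hκ⟩ := hτ.exists_norm_gnsVec_le_norm_diagonal
  let e : M →ₗ[ℂ] lp (fun _ : ℕ => H) 2 :=
    { toFun := fun x => (x : H →L[ℂ] H).diagonal κ
      map_add' := fun x y => by ext n; rfl
      map_smul' := fun c x => by ext n; rfl }
  exact ⟨κ, exists_intertwiner_of_norm_le e τ.gnsVec hκ (fun x => (x : H →L[ℂ] H).diagonal)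
    (fun x => τ.gnsNonUnitalStarAlgHom x) (fun _ _ => rfl)
    (fun x y => PositiveLinearMap.gnsNonUnitalStarAlgHom_apply_coe τ)
    (fun x => ContinuousLinearMap.inner_diagonal_left (x : H →L[ℂ] H))⟩

/-- A faithful normal trace is a vector functional of the diagonal action on `ℓ²(ℕ, H)`. -/
lemma exists_eq_inner_diagonal (hτ : M.IsFaithfulNormalTrace τ) :
    ∃ ζ : lp (fun _ : ℕ => H) 2, ∀ x : M, τ x = inner ℂ ζ ((x : H →L[ℂ] H).diagonal ζ) := by
  obtain ⟨κ, W, hW, hint⟩ := hτ.exists_intertwiner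
  -- `B = W* W` commutes with the diagonal action, hence so does its square root `R`. Therefore
  -- `⟨Rκ, x Rκ⟩ = ⟨κ, B x κ⟩ = ⟨Wκ, W x κ⟩ = τ x`, which makes `Rκ` the required vector.
  obtain ⟨B, hB0, hBinner⟩ : ∃ B : lp (fun _ : ℕ => H) 2 →L[ℂ] lp (fun _ : ℕ => H) 2,
      0 ≤ B ∧ ∀ v w, inner ℂ v (B w) = inner ℂ (W v) (W w) := by
    refine ⟨W.adjoint ∘L W, ?_, fun v w => ContinuousLinearMap.adjoint_inner_right W v (W w)⟩
    rw [ContinuousLinearMap.nonneg_iff_isPositive]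
    exact ContinuousLinearMap.isPositive_adjoint_comp_self W
  have hcomm : ∀ x : M, Commute B (x : H →L[ℂ] H).diagonal := by
    intro x
    refine ContinuousLinearMap.ext fun v => ext_inner_left ℂ fun w => ?_
    rw [mul_apply_eq_comp, mul_apply_eq_comp, hBinner, hint]
    have h1 : inner ℂ w ((x : H →L[ℂ] H).diagonal (B v))
        = inner ℂ (((star x : M) : H →L[ℂ] H).diagonal w) (B v) := by
      rw [ContinuousLinearMap.inner_diagonal_left]
      simp
    rw [h1, hBinner, hint, map_star, ContinuousLinearMap.star_eq_adjoint,
      ContinuousLinearMap.adjoint_inner_left]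
  obtain ⟨R, hRsa, hRR, hRcomm'⟩ := ContinuousLinearMap.exists_sqrt hB0
  have hRcomm := fun x => hRcomm' _ (hcomm x)
  refine ⟨R κ, fun x => ?_⟩
  have h1 : (x : H →L[ℂ] H).diagonal (R κ) = R ((x : H →L[ℂ] H).diagonal κ) :=
    (DFunLike.congr_fun (hRcomm x).eq κ).symm
  have h2 : ∀ v, R (R v) = B v := fun v => DFunLike.congr_fun hRR v
  have h3 : W κ = τ.gnsVec 1 := hW 1
  rw [h1, ← ContinuousLinearMap.adjoint_inner_right, ← ContinuousLinearMap.star_eq_adjoint,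
    hRsa.star_eq, h2, hBinner, hW, h3, PositiveLinearMap.inner_gnsVec, star_one, one_mul]

/-- Multiplication by a fixed element followed by a faithful normal trace is an ultraweak
functional. -/
lemma exists_mul_eq_ultraweakFunctional (hτ : M.IsFaithfulNormalTrace τ) (z : M) :
    ∃ p : lp (fun _ : ℕ => H) 2 × lp (fun _ : ℕ => H) 2,
      ∀ x, τ (z * x) = M.ultraweakFunctional p.1 p.2 x := by
  obtain ⟨ζ, hζ⟩ := hτ.exists_eq_inner_diagonal
  refine ⟨(ζ, ((star z : M) : H →L[ℂ] H).diagonal ζ), fun x => ?_⟩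
  rw [hζ, ultraweakFunctional_eq_inner, ContinuousLinearMap.inner_diagonal_left]
  change inner ℂ ζ (((z : H →L[ℂ] H) * x).diagonal ζ) = _
  rw [ContinuousLinearMap.diagonal_mul]
  simp

/-- The image of the operator interval `[0, 1]` in `L²(M, τ)` is closed. -/
lemma isClosed_gnsVec_image_Icc (hτ : M.IsFaithfulNormalTrace τ) :
    IsClosed (τ.gnsVec '' Set.Icc 0 1) := by
  refine isClosed_of_closure_subset fun ξ hξ => ?_
  obtain ⟨s, hs, hlim⟩ := mem_closure_iff_seq_limit.mp hξ
  choose x hx hxs using hs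
  have hn : ∀ n, ‖x n‖ ≤ 1 := fun n =>
    (CStarAlgebra.norm_le_one_iff_of_nonneg (x n) (hx n).1).mpr (hx n).2
  -- A weak operator limit along an ultrafilter stays in `[0, 1]`. It represents `ξ` because the
  -- functionals `τ (star z * ·)` are ultraweak and the vectors `τ.gnsVec z` are dense.
  obtain ⟨y, hy⟩ := M.exists_tendsto_inner_of_bounded (Filter.hyperfilter ℕ) x hn
  have hle : (Filter.hyperfilter ℕ : Filter ℕ) ≤ Filter.atTop := Nat.hyperfilter_le_atTop
  refine ⟨y, ⟨M.nonneg_of_tendsto_inner (fun n => (hx n).1) hy, ?_⟩, ?_⟩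
  · rw [← sub_nonneg]
    refine M.nonneg_of_tendsto_inner (x := fun n => 1 - x n) (f := (Filter.hyperfilter ℕ : Filter ℕ))
      (fun n => sub_nonneg.mpr (hx n).2) fun v w => ?_
    have := (tendsto_const_nhds (x := inner ℂ w v)).sub (hy v w)
    simpa [inner_sub_right] using this
  · have hcont : ∀ w : τ.GNS, Continuous fun v : τ.GNS => (inner ℂ v w : ℂ) := fun w => by fun_prop
    refine ext_inner_left ℂ (congrFun (τ.denseRange_gnsVec.equalizer (hcont (τ.gnsVec y)) (hcont ξ)
      (funext fun z => ?_)))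
    obtain ⟨p, hp⟩ := hτ.exists_mul_eq_ultraweakFunctional (star z)
    have h1 := M.tendsto_ultraweakFunctional hn hy p.1 p.2
    have h2 : Filter.Tendsto (fun n => inner ℂ (τ.gnsVec z) (s n))
        (Filter.hyperfilter ℕ : Filter ℕ) (𝓝 (inner ℂ (τ.gnsVec z) ξ)) :=
      (Filter.Tendsto.inner tendsto_const_nhds hlim).mono_left hle
    refine tendsto_nhds_unique ?_ h2
    simp only [Function.comp_apply, PositiveLinearMap.inner_gnsVec, hp]
    refine h1.congr fun n => ?_
    rw [← hxs, PositiveLinearMap.inner_gnsVec, hp]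

end IsFaithfulNormalTrace

end VonNeumannAlgebra

/-! ### Norm estimates for the functionals `τ (z * ·)` -/

namespace PositiveLinearMap.IsFaithfulTracialState

variable {A : Type*} [CStarAlgebra A] [PartialOrder A] [StarOrderedRing A] {τ : A →ₚ[ℂ] ℂ}

/-- Test the functional on a contraction `k` that approximates the positive spectral projection of
`d`: `τ d⁺ ≤ τ (d * k) + ε ≤ c + ε` in real parts. -/
lemma re_posPart_le (h : τ.IsFaithfulTracialState) {d : A} (hd : IsSelfAdjoint d) {c : ℝ}
    (hdc : ∀ x, ‖τ (d * x)‖ ≤ c * ‖x‖) : (τ d⁺).re ≤ c := by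
  have hc : 0 ≤ c := by
    have h1 : ‖(1 : A)‖ ≤ 1 :=
      (CStarAlgebra.norm_le_one_iff_of_nonneg (1 : A) zero_le_one).mpr le_rfl
    have h2 := (norm_nonneg _).trans (hdc 1)
    have h3 : 0 < ‖(1 : A)‖ := by
      refine norm_pos_iff.mpr fun h0 => ?_
      have := h.map_one
      rw [h0, map_zero] at this
      exact zero_ne_one this
    exact nonneg_of_mul_nonneg_left h2 h3
  refine le_of_forall_pos_le_add fun ε hε => ?_
  obtain ⟨k, hk0, hk1, hk⟩ := exists_posPart_le_mul_add hd hε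
  have h1 := τ.re_mono hk
  rw [map_add, Complex.add_re, Algebra.algebraMap_eq_smul_one, ← Complex.coe_smul, map_smul,
    h.map_one, h.tracial] at h1
  have h2 : (τ (d * k)).re ≤ c := (Complex.re_le_norm _).trans ((hdc k).trans
    (mul_le_of_le_one_right hc ((CStarAlgebra.norm_le_one_iff_of_nonneg k hk0).mpr hk1)))
  have h3 : ((ε : ℂ) • (1 : ℂ)).re = ε := by simp
  rw [h3] at h1
  linarith

open scoped ComplexStarModule in
/-- An element `d` for which `x ↦ τ (d * x)` has norm at most `c` is a combination of positive
elements of trace at most `c`. -/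
lemma exists_decomposition (h : τ.IsFaithfulTracialState) {d : A} {c : ℝ}
    (hdc : ∀ x, ‖τ (d * x)‖ ≤ c * ‖x‖) :
    ∃ r : Fin 4 → A, (∀ k, 0 ≤ r k) ∧ (∀ k, (τ (r k)).re ≤ c) ∧
      d = r 0 - r 1 + Complex.I • (r 2 - r 3) := by
  have hdc' : ∀ x, ‖τ (star d * x)‖ ≤ c * ‖x‖ := by
    intro x
    have h1 : τ (star d * x) = star (τ (d * star x)) := by
      rw [← map_star, star_mul, star_star, h.tracial]
    rw [h1, norm_star, ← norm_star x]
    exact hdc _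
  have hre : ∀ x, ‖τ ((ℜ d : A) * x)‖ ≤ c * ‖x‖ := by
    intro x
    rw [realPart_apply_coe, ← Complex.coe_smul, smul_mul_assoc, map_smul, add_mul, map_add,
      norm_smul]
    have h1 := norm_add_le (τ (d * x)) (τ (star d * x))
    have h2 := hdc x
    have h3 := hdc' x
    have h4 : ‖(((2 : ℝ)⁻¹ : ℝ) : ℂ)‖ = 2⁻¹ := by simp
    rw [h4]
    linarith
  have him : ∀ x, ‖τ ((ℑ d : A) * x)‖ ≤ c * ‖x‖ := by
    intro x
    rw [imaginaryPart_apply_coe, ← Complex.coe_smul, smul_mul_assoc, smul_mul_assoc, map_smul,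
      map_smul, sub_mul, map_sub, norm_smul, norm_smul]
    have h1 := norm_sub_le (τ (d * x)) (τ (star d * x))
    have h2 := hdc x
    have h3 := hdc' x
    have h4 : ‖(((2 : ℝ)⁻¹ : ℝ) : ℂ)‖ = 2⁻¹ := by simp
    rw [h4, norm_neg, Complex.norm_I]
    linarith
  have hneg : ∀ {a : A}, (∀ x, ‖τ (a * x)‖ ≤ c * ‖x‖) → ∀ x, ‖τ (-a * x)‖ ≤ c * ‖x‖ := by
    intro a ha x
    rw [neg_mul, map_neg, norm_neg]
    exact ha x
  have hres : IsSelfAdjoint (ℜ d : A) := (ℜ d).2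
  have hims : IsSelfAdjoint (ℑ d : A) := (ℑ d).2
  refine ⟨![(ℜ d : A)⁺, (ℜ d : A)⁻, (ℑ d : A)⁺, (ℑ d : A)⁻], ?_, ?_, ?_⟩
  · intro k
    fin_cases k
    exacts [CFC.posPart_nonneg _, CFC.negPart_nonneg _, CFC.posPart_nonneg _, CFC.negPart_nonneg _]
  · intro k
    fin_cases k
    · exact h.re_posPart_le hres hre
    · have := h.re_posPart_le hres.neg (hneg hre)
      rwa [CFC.posPart_neg] at this
    · exact h.re_posPart_le hims him
    · have := h.re_posPart_le hims.neg (hneg him)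
      rwa [CFC.posPart_neg] at this
  · change d = (ℜ d : A)⁺ - (ℜ d : A)⁻ + Complex.I • ((ℑ d : A)⁺ - (ℑ d : A)⁻)
    rw [CFC.posPart_sub_negPart _ hres, CFC.posPart_sub_negPart _ hims,
      realPart_add_I_smul_imaginaryPart]

/-- A functional dominated by `max ‖x‖ (δ⁻¹ * ‖x‖₂)` up to a small constant is close in norm to some
`x ↦ τ (z * x)`. -/
lemma exists_norm_sub_le (h : τ.IsFaithfulTracialState) {ψ : A →ₗ[ℂ] ℂ} {ε δ : ℝ} (hε : 0 < ε)
    (hδ : 0 < δ) (hψ : ∀ x, ‖x‖ ≤ 1 → ‖τ.gnsVec x‖ ≤ δ → ‖ψ x‖ ≤ ε) :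
    ∃ z : A, ∀ x, ‖ψ x - τ (z * x)‖ ≤ 2 * ε * ‖x‖ := by
  -- The hypothesis says that `ψ` has norm at most `ε` for the norm pulled back along `j`. A
  -- Hahn–Banach extension to the product splits into a functional of norm at most `ε` on `A` and an
  -- `L²` functional, whose representing vector is approximated within `ε` by an algebra element.
  let j : A →ₗ[ℂ] A × τ.GNS := LinearMap.prod LinearMap.id ((δ⁻¹ : ℂ) • τ.gnsVec)
  have hjinj : Function.Injective j := fun x y hxy => congrArg Prod.fst hxy
  have hδn : ‖(δ⁻¹ : ℂ)‖ = δ⁻¹ := by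
    rw [norm_inv, Complex.norm_real, Real.norm_of_nonneg hδ.le]
  have hjn : ∀ x, ‖j x‖ = max ‖x‖ (δ⁻¹ * ‖τ.gnsVec x‖) := by
    intro x
    rw [← hδn, ← norm_smul]
    rfl
  have hbound : ∀ x, ‖ψ x‖ ≤ ε * ‖j x‖ := by
    intro x
    rcases eq_or_ne x 0 with rfl | hx
    · simp
    have hx0 : 0 < ‖j x‖ := norm_pos_iff.mpr fun h0 => hx (hjinj (h0.trans (map_zero j).symm))
    have hs : ‖((‖j x‖⁻¹ : ℝ) : ℂ)‖ = ‖j x‖⁻¹ := by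
      rw [Complex.norm_real, Real.norm_of_nonneg (by positivity)]
    have h1 := hψ (((‖j x‖⁻¹ : ℝ) : ℂ) • x)
      (by
        rw [norm_smul, hs, inv_mul_le_one₀ hx0, hjn]
        exact le_max_left _ _)
      (by
        have h3 : δ⁻¹ * ‖τ.gnsVec x‖ ≤ ‖j x‖ := by
          rw [hjn]
          exact le_max_right _ _
        rw [map_smul, norm_smul, hs, inv_mul_le_iff₀ hx0]
        rwa [inv_mul_le_iff₀ hδ, mul_comm δ] at h3)
    rw [map_smul, norm_smul, hs, inv_mul_le_iff₀ hx0] at h1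
    linarith
  let eqv := LinearEquiv.ofInjective j hjinj
  let f : StrongDual ℂ (LinearMap.range j) :=
    (ψ ∘ₗ eqv.symm.toLinearMap).mkContinuous ε (by
      intro v
      obtain ⟨x, rfl⟩ := eqv.surjective v
      rw [LinearMap.comp_apply, LinearEquiv.coe_coe, LinearEquiv.symm_apply_apply]
      exact hbound x)
  obtain ⟨g, hg, hgn⟩ := exists_extension_norm_eq (LinearMap.range j) f
  have hgε : ‖g‖ ≤ ε := hgn.le.trans (LinearMap.mkContinuous_norm_le _ hε.le _)
  have hgj : ∀ x, g (j x) = ψ x := by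
    intro x
    have h1 := hg (eqv x)
    have h2 : f (eqv x) = ψ (eqv.symm (eqv x)) := rfl
    rw [LinearEquiv.symm_apply_apply] at h2
    exact h1.trans h2
  let g₂ : StrongDual ℂ τ.GNS := (δ⁻¹ : ℂ) • (g ∘L ContinuousLinearMap.inr ℂ A τ.GNS)
  set η := (InnerProductSpace.toDual ℂ τ.GNS).symm g₂ with hη
  have hgη : ∀ v, g₂ v = inner ℂ η v := fun v => by
    rw [hη, InnerProductSpace.toDual_symm_apply]
  obtain ⟨z, hz⟩ := τ.denseRange_gnsVec.exists_dist_lt η hε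
  refine ⟨star z, fun x => ?_⟩
  have h1 : ψ x = g (x, 0) + g₂ (τ.gnsVec x) := by
    rw [← hgj]
    have : j x = (x, 0) + (δ⁻¹ : ℂ) • ((0 : A), τ.gnsVec x) := by
      simp [j]
    rw [this, map_add, map_smul]
    rfl
  rw [h1, hgη, ← inner_gnsVec, add_sub_assoc, ← inner_sub_left]
  have h2 : ‖g (x, 0)‖ ≤ ε * ‖x‖ := by
    refine (g.le_opNorm _).trans ?_
    have : ‖((x, 0) : A × τ.GNS)‖ = ‖x‖ := by simp [Prod.norm_def]
    rw [this]
    gcongr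
  have h3 : ‖inner ℂ (η - τ.gnsVec z) (τ.gnsVec x)‖ ≤ ε * ‖x‖ := by
    refine (norm_inner_le_norm _ _).trans ?_
    rw [← dist_eq_norm]
    gcongr
    exact h.norm_gnsVec_le x
  calc _ ≤ _ := norm_add_le _ _
    _ ≤ ε * ‖x‖ + ε * ‖x‖ := add_le_add h2 h3
    _ = 2 * ε * ‖x‖ := by ring

end PositiveLinearMap.IsFaithfulTracialState

/-! ### Normality and ultraweak convergence detected by the trace -/

namespace VonNeumannAlgebra

variable {H : Type*} [NormedAddCommGroup H] [InnerProductSpace ℂ H] [CompleteSpace H]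
  {M : VonNeumannAlgebra H} {τ : M →ₚ[ℂ] ℂ}

namespace IsFaithfulNormalTrace

/-- Ultraweak functionals are norm limits of functionals `x ↦ τ (z * x)`. -/
lemma exists_norm_ultraweakFunctional_sub_le (hτ : M.IsFaithfulNormalTrace τ)
    (p : lp (fun _ : ℕ => H) 2 × lp (fun _ : ℕ => H) 2) {ε : ℝ} (hε : 0 < ε) :
    ∃ z : M, ∀ x, ‖M.ultraweakFunctional p.1 p.2 x - τ (z * x)‖ ≤ ε * ‖x‖ := by
  -- An ultraweak functional is `‖·‖₂`-continuous at `0` on the unit ball. Otherwise a sequence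
  -- tends to `0` in `L²` while its values stay away from `0`; its weak limit `y` satisfies `τ (star
  -- y * y) = 0`, so `y = 0` and the values tend to `0` along the ultrafilter.
  obtain ⟨δ, hδ, hδp⟩ : ∃ δ : ℝ, 0 < δ ∧ ∀ x : M, ‖x‖ ≤ 1 → ‖τ.gnsVec x‖ ≤ δ →
      ‖M.ultraweakFunctionalₗ p x‖ ≤ ε / 2 := by
    by_contra! hcon
    choose x hx1 hx2 hx3 using fun n : ℕ => hcon (1 / ((n : ℝ) + 1)) Nat.one_div_pos_of_nat
    obtain ⟨y, hy⟩ := M.exists_tendsto_inner_of_bounded (Filter.hyperfilter ℕ) x hx1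
    have hle : (Filter.hyperfilter ℕ : Filter ℕ) ≤ Filter.atTop := Nat.hyperfilter_le_atTop
    have hx0 : Filter.Tendsto (fun n => τ.gnsVec (x n)) (Filter.hyperfilter ℕ : Filter ℕ) (𝓝 0) :=
      (squeeze_zero_norm hx2 tendsto_one_div_add_atTop_nhds_zero_nat).mono_left hle
    have hy0 : y = 0 := by
      refine hτ.faithful y ?_
      obtain ⟨q, hq⟩ := hτ.exists_mul_eq_ultraweakFunctional (star y)
      rw [hq]
      refine tendsto_nhds_unique (M.tendsto_ultraweakFunctional hx1 hy q.1 q.2) ?_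
      have : Filter.Tendsto (fun n => inner ℂ (τ.gnsVec y) (τ.gnsVec (x n)))
          (Filter.hyperfilter ℕ : Filter ℕ) (𝓝 (inner ℂ (τ.gnsVec y) 0)) :=
        Filter.Tendsto.inner tendsto_const_nhds hx0
      rw [inner_zero_right] at this
      refine this.congr fun n => ?_
      rw [PositiveLinearMap.inner_gnsVec, hq]
    have hlim := (M.tendsto_ultraweakFunctional hx1 hy p.1 p.2).norm
    have h0 : M.ultraweakFunctional p.1 p.2 y = 0 := by
      rw [hy0]
      exact map_zero (M.ultraweakFunctionalₗ p)
    rw [h0, norm_zero] at hlim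
    have := ge_of_tendsto' hlim fun n => (hx3 n).le
    linarith
  obtain ⟨z, hz⟩ := hτ.isFaithfulTracialState.exists_norm_sub_le (half_pos hε) hδ hδp
  refine ⟨z, fun x => (hz x).trans_eq ?_⟩
  ring

/-- If `∑ τ(rₙ) < ∞` for positive elements `rₙ`, then `x ↦ ∑ τ(rₙ x)` is an ultraweak
functional. -/
lemma exists_hasSum_mul_eq_ultraweakFunctional (hτ : M.IsFaithfulNormalTrace τ) {r : ℕ → M}
    (hr : ∀ n, 0 ≤ r n) (hs : Summable fun n => (τ (r n)).re) :
    ∃ p : lp (fun _ : ℕ => H) 2 × lp (fun _ : ℕ => H) 2, ∀ x : M,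
      HasSum (fun n => τ (r n * x)) (M.ultraweakFunctional p.1 p.2 x) := by
  obtain ⟨ζ, hζ⟩ := hτ.exists_eq_inner_diagonal
  choose c hc using fun n => NonUnitalCStarAlgebra.exists_eq_star_mul_self (hr n)
  -- With `r n = star (c n) * c n`, traciality gives `⟨v n, x (v n)⟩ = τ (r n * x)` and `‖v n‖² = τ
  -- (r n)`. The vectors `v n` can thus be joined into one square-summable family over `ℕ × ℕ`.
  let v : ℕ → lp (fun _ : ℕ => H) 2 := fun n => ((star (c n) : M) : H →L[ℂ] H).diagonal ζ
  have hinner : ∀ n (x : M),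
      inner ℂ (v n) ((x : H →L[ℂ] H).diagonal (v n)) = τ (r n * x) := by
    intro n x
    rw [hc, mul_assoc, hτ.tracial, mul_assoc, hζ, ContinuousLinearMap.inner_diagonal_left]
    change _ = inner ℂ ζ (((c n : H →L[ℂ] H) * (x * star (c n : H →L[ℂ] H))).diagonal ζ)
    rw [ContinuousLinearMap.diagonal_mul, ContinuousLinearMap.diagonal_mul]
    simp [v]
  have hnorm : ∀ n, ‖v n‖ ^ 2 = (τ (r n)).re := by
    intro n
    have h1 := hinner n 1
    have h2 : ((1 : M) : H →L[ℂ] H).diagonal = 1 := ContinuousLinearMap.diagonal_one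
    rw [mul_one, h2] at h1
    rw [← h1, ← inner_self_eq_norm_sq (𝕜 := ℂ)]
    rfl
  have hsum : Summable fun i : ℕ × ℕ => ‖v i.1 i.2‖ ^ 2 := by
    rw [summable_prod_of_nonneg (fun _ => by positivity)]
    refine ⟨fun n => lp.summable_norm_sq (v n), ?_⟩
    simp only [← lp.norm_sq_eq_tsum, hnorm]
    exact hs
  obtain ⟨p, hp⟩ := M.exists_hasSum_eq_ultraweakFunctional Nat.pairEquiv.symm hsum hsum
  refine ⟨p, fun x => (hp x).prod_fiberwise fun n => ?_⟩
  rw [← hinner]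
  exact lp.hasSum_inner (v n) ((x : H →L[ℂ] H).diagonal (v n))

/-- A norm limit of functionals `x ↦ τ (z * x)` is ultraweakly continuous. -/
lemma continuous_of_forall_exists_norm_sub_le (hτ : M.IsFaithfulNormalTrace τ) {ψ : M → ℂ}
    (hψ : ∀ ε : ℝ, 0 < ε → ∃ z : M, ∀ x, ‖ψ x - τ (z * x)‖ ≤ ε * ‖x‖) :
    Continuous[M.ultraweakTopology, inferInstance] ψ := by
  -- Geometric errors make the increments `z (n + 1) - z n` summable as functionals. Splitting each
  -- into four positive elements of small trace turns the telescoping series into four ultraweak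
  -- functionals added to `τ (z 0 * ·)`.
  choose z hz using fun n : ℕ => hψ ((1 / 2) ^ n) (by positivity)
  have hd : ∀ n x, ‖τ ((z (n + 1) - z n) * x)‖ ≤ (2 * (1 / 2) ^ n) * ‖x‖ := by
    intro n x
    have h1 : τ ((z (n + 1) - z n) * x) = (ψ x - τ (z n * x)) - (ψ x - τ (z (n + 1) * x)) := by
      rw [sub_mul, map_sub]; ring
    rw [h1]
    have h2 := hz n x
    have h3 := hz (n + 1) x
    have h4 := norm_sub_le (ψ x - τ (z n * x)) (ψ x - τ (z (n + 1) * x))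
    have h5 : ((1 : ℝ) / 2) ^ (n + 1) * ‖x‖ ≤ (1 / 2) ^ n * ‖x‖ := by
      gcongr ?_ * _
      exact pow_le_pow_of_le_one (by norm_num) (by norm_num) n.le_succ
    linarith
  choose r hr0 hrτ hr using fun n => hτ.isFaithfulTracialState.exists_decomposition (hd n)
  have hsum : ∀ k, Summable fun n => (τ (r n k)).re := fun k =>
    (summable_geometric_two.mul_left 2).of_nonneg_of_le
      (fun n => τ.re_nonneg_of_nonneg (hr0 n k)) (fun n => hrτ n k)
  choose p hp using fun k => hτ.exists_hasSum_mul_eq_ultraweakFunctional (fun n => hr0 n k) (hsum k)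
  obtain ⟨q, hq⟩ := hτ.exists_mul_eq_ultraweakFunctional (z 0)
  have key : ψ = fun x => M.ultraweakFunctional q.1 q.2 x +
      (M.ultraweakFunctional (p 0).1 (p 0).2 x - M.ultraweakFunctional (p 1).1 (p 1).2 x +
      Complex.I * (M.ultraweakFunctional (p 2).1 (p 2).2 x -
        M.ultraweakFunctional (p 3).1 (p 3).2 x)) := by
    funext x
    have h1 : Filter.Tendsto (fun n => τ (z n * x)) Filter.atTop (𝓝 (ψ x)) := by
      rw [tendsto_iff_norm_sub_tendsto_zero]
      have h2 : Filter.Tendsto (fun n : ℕ => (1 / 2 : ℝ) ^ n * ‖x‖) Filter.atTop (𝓝 0) := by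
        simpa using (tendsto_pow_atTop_nhds_zero_of_lt_one (r := (1 / 2 : ℝ)) (by norm_num)
          (by norm_num)).mul_const ‖x‖
      refine squeeze_zero (fun _ => norm_nonneg _) (fun n => ?_) h2
      rw [norm_sub_rev]
      exact hz n x
    have h3 := ((hp 0 x).sub (hp 1 x)).add (((hp 2 x).sub (hp 3 x)).mul_left Complex.I)
    have h4 := h3.tendsto_sum_nat
    have h5 : ∀ n, ∑ i ∈ Finset.range n, (τ (r i 0 * x) - τ (r i 1 * x) +
        Complex.I * (τ (r i 2 * x) - τ (r i 3 * x))) = τ (z n * x) - τ (z 0 * x) := by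
      intro n
      rw [← Finset.sum_range_sub (fun n => τ (z n * x)) n]
      refine Finset.sum_congr rfl fun i _ => ?_
      rw [← map_sub τ (z (i + 1) * x), ← sub_mul, hr i]
      simp only [add_mul, sub_mul, smul_mul_assoc, map_add, map_sub, map_smul, smul_eq_mul]
    simp only [h5] at h4
    have h6 := tendsto_nhds_unique h4 (h1.sub_const (τ (z 0 * x)))
    rw [h6, ← hq]
    ring
  rw [key]
  let _ : TopologicalSpace M := M.ultraweakTopology
  exact (M.continuous_ultraweakFunctional _ _).add (((M.continuous_ultraweakFunctional _ _).sub
    (M.continuous_ultraweakFunctional _ _)).add (continuous_const.mul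
    ((M.continuous_ultraweakFunctional _ _).sub (M.continuous_ultraweakFunctional _ _))))

/-- A contraction of `M` which has an adjoint for the trace is normal. -/
lemma isNormalMap_of_adjoint (hτ : M.IsFaithfulNormalTrace τ) {R R' : M →ₗ[ℂ] M}
    (hR : ∀ x, ‖R x‖ ≤ ‖x‖) (hadj : ∀ z x, τ (z * R x) = τ (R' z * x)) : M.IsNormalMap R := by
  refine continuous_iInf_rng.mpr fun p => continuous_induced_rng.mpr ?_
  refine hτ.continuous_of_forall_exists_norm_sub_le fun ε hε => ?_
  obtain ⟨z, hz⟩ := hτ.exists_norm_ultraweakFunctional_sub_le p hε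
  -- If `τ (z * ·)` is close to the functional `φ`, then `τ (z * R ·) = τ (R' z * ·)` is as close to
  -- `φ ∘ R`, since `R` is contractive.
  refine ⟨R' z, fun x => ?_⟩
  rw [← hadj]
  exact (hz (R x)).trans (by gcongr; exact hR x)

/-- A bounded net converging weakly in `L²(M, τ)` converges ultraweakly. -/
lemma tendsto_ultraweak_of_tendsto_trace (hτ : M.IsFaithfulNormalTrace τ) {α : Type*}
    {f : Filter α} {x : α → M} {y : M} {C : ℝ} (hx : ∀ a, ‖x a - y‖ ≤ C)
    (h : ∀ z, Filter.Tendsto (fun a => τ (z * (x a - y))) f (𝓝 0)) :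
    Filter.Tendsto x f (@nhds M M.ultraweakTopology y) := by
  rw [nhds_iInf]
  refine Filter.tendsto_iInf.mpr fun p => ?_
  rw [nhds_induced, Filter.tendsto_comap_iff]
  have hsub : ∀ a, M.ultraweakFunctional p.1 p.2 (x a) - M.ultraweakFunctional p.1 p.2 y
      = M.ultraweakFunctional p.1 p.2 (x a - y) :=
    fun a => (map_sub (M.ultraweakFunctionalₗ p) (x a) y).symm
  rw [Metric.tendsto_nhds]
  intro ε hε
  have hC : 0 < |C| + 1 := by positivity
  obtain ⟨z, hz⟩ := hτ.exists_norm_ultraweakFunctional_sub_le p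
    (show 0 < ε / (2 * (|C| + 1)) by positivity)
  filter_upwards [(Metric.tendsto_nhds.mp (h z)) (ε / 2) (half_pos hε)] with a ha
  rw [dist_zero_right] at ha
  rw [Function.comp_apply, dist_eq_norm, hsub]
  have h1 := hz (x a - y)
  have h2 : ε / (2 * (|C| + 1)) * ‖x a - y‖ ≤ ε / 2 := by
    have h3 : ‖x a - y‖ ≤ |C| + 1 := (hx a).trans ((le_abs_self C).trans (by linarith))
    calc _ ≤ ε / (2 * (|C| + 1)) * (|C| + 1) := by gcongr
      _ = ε / 2 := by field_simp
  have h4 := norm_add_le (M.ultraweakFunctional p.1 p.2 (x a - y) - τ (z * (x a - y)))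
    (τ (z * (x a - y)))
  rw [sub_add_cancel] at h4
  linarith

end IsFaithfulNormalTrace

end VonNeumannAlgebra

/-! ### Construction of the symmetric net and the value of the constant -/

open WithCStarModule in
lemma CStarMatrix.norm_ofMatrix_const_le {A : Type*} [CStarAlgebra A] [PartialOrder A]
    [StarOrderedRing A] (x : A) :
    ‖(CStarMatrix.ofMatrix fun _ _ => x : CStarMatrix (Fin 1) (Fin 1) A)‖ ≤ ‖x‖ := by
  rw [CStarMatrix.norm_def]
  refine ContinuousLinearMap.opNorm_le_bound _ (norm_nonneg _) fun v => ?_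
  refine (pi_norm_le_sum_norm _).trans ?_
  rw [Fin.sum_univ_one, CStarMatrix.toCLM_apply_eq_sum]
  simp only [Fin.sum_univ_one, equiv_symm_pi_apply]
  change ‖v 0 * x‖ ≤ _
  rw [mul_comm ‖x‖]
  exact (norm_mul_le _ _).trans (by gcongr; exact norm_apply_le_norm v 0)

namespace VonNeumannAlgebra

variable {H : Type*} [NormedAddCommGroup H] [InnerProductSpace ℂ H] [CompleteSpace H]
  {M : VonNeumannAlgebra H} {τ : M →ₚ[ℂ] ℂ}

lemma cbNorm_le_one_of_norm_map_le {R : M →ₗ[ℂ] M}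
    (hR : ∀ (n : ℕ) (X : CStarMatrix (Fin n) (Fin n) M), ‖X‖ ≤ 1 → ‖X.map R‖ ≤ 1) :
    M.cbNorm R ≤ 1 := by
  refine iSup_le fun n => iSup_le fun X => iSup_le fun hX => ?_
  rw [← ofReal_norm]
  exact ENNReal.ofReal_le_one.mpr (hR n X hX)

lemma norm_apply_le_of_norm_map_le {R : M →ₗ[ℂ] M}
    (hR : ∀ (n : ℕ) (X : CStarMatrix (Fin n) (Fin n) M), ‖X‖ ≤ 1 → ‖X.map R‖ ≤ 1) (x : M) :
    ‖R x‖ ≤ ‖x‖ := by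
  rcases eq_or_ne x 0 with rfl | hx
  · simp
  have hx0 : 0 < ‖x‖ := norm_pos_iff.mpr hx
  set y : M := ((‖x‖⁻¹ : ℝ) : ℂ) • x with hy
  have hs : ‖((‖x‖⁻¹ : ℝ) : ℂ)‖ = ‖x‖⁻¹ := by
    rw [Complex.norm_real, Real.norm_of_nonneg (by positivity)]
  have hyn : ‖y‖ ≤ 1 := by rw [hy, norm_smul, hs, inv_mul_cancel₀ hx0.ne']
  let X : CStarMatrix (Fin 1) (Fin 1) M := CStarMatrix.ofMatrix fun _ _ => y
  have hX : ‖X‖ ≤ 1 :=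
    (CStarMatrix.norm_ofMatrix_const_le y).trans hyn
  have h1 : ‖(X.map R) 0 0‖ ≤ 1 := CStarMatrix.norm_entry_le_norm.trans (hR 1 X hX)
  have h2 : (X.map R) 0 0 = R y := rfl
  rw [h2, hy, map_smul, norm_smul, hs, inv_mul_le_one₀ hx0] at h1
  exact h1

lemma norm_apply_one_le_cbNorm (R : M →ₗ[ℂ] M) : ‖R 1‖ₑ ≤ M.cbNorm R := by
  have h1 : ‖(1 : CStarMatrix (Fin 1) (Fin 1) M)‖ ≤ 1 :=
    (CStarAlgebra.norm_le_one_iff_of_nonneg _ zero_le_one).mpr le_rfl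
  refine le_trans ?_ (le_iSup_of_le 1 (le_iSup_of_le (1 : CStarMatrix (Fin 1) (Fin 1) M)
    (le_iSup_of_le h1 le_rfl)))
  have h2 : ((1 : CStarMatrix (Fin 1) (Fin 1) M).map R) 0 0 = R 1 := by
    rw [CStarMatrix.map_apply, CStarMatrix.one_apply_eq]
  rw [← ofReal_norm, ← ofReal_norm, ← h2]
  exact ENNReal.ofReal_le_ofReal CStarMatrix.norm_entry_le_norm

namespace IsFaithfulNormalTrace

/-- Cutting down a completely positive map `T` with `τ ∘ T ≤ τ` to a completely contractive one. -/
lemma exists_contractive_cutoff (hτ : M.IsFaithfulNormalTrace τ) (T : M →CP M)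
    (hT : ∀ x : M, 0 ≤ x → τ (T x) ≤ τ x) (hc : M.ExtendsToCompact τ T.toLinearMap) :
    ∃ (T₁ : M →ₗ[ℂ] M) (S : τ.GNS →L[ℂ] τ.GNS), (∀ x, 0 ≤ x → 0 ≤ T₁ x) ∧ T₁ 1 ≤ 1 ∧
      (∀ x, 0 ≤ x → (τ (T₁ x)).re ≤ (τ x).re) ∧ τ.IsTraceCompletelyPositive T₁ ∧
      IsCompactOperator S ∧ (∀ x, S (τ.gnsVec x) = τ.gnsVec (T₁ x)) ∧
      ∀ x, ‖τ.gnsVec (T₁ x - x)‖ ≤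
        ‖τ.gnsVec (T x - x)‖ + 2 * ‖x‖ * ‖τ.gnsVec (T 1 - 1)‖ := by
  have h := hτ.isFaithfulTracialState
  obtain ⟨S₀, hS₀, hS₀T⟩ := hc
  have hTpos : ∀ x : M, 0 ≤ x → 0 ≤ T x := fun x hx => map_nonneg T hx
  obtain ⟨a, ha0, ha1, hab, ha⟩ := PositiveLinearMap.exists_cutoff (hTpos 1 zero_le_one)
  have hasa : star a = a := (IsSelfAdjoint.of_nonneg ha0).star_eq
  have han : ‖a‖ ≤ 1 := (CStarAlgebra.norm_le_one_iff_of_nonneg a ha0).mpr ha1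
  have haa : a * a ≤ 1 := by
    have := CStarAlgebra.norm_le_one_iff_of_nonneg (a * a)
      (by simpa [hasa] using star_mul_self_nonneg a)
    exact this.mp ((norm_mul_le a a).trans (mul_le_one₀ han (norm_nonneg _) han))
  obtain ⟨L, hL⟩ := PositiveLinearMap.exists_clm_of_norm_gnsVec_le (τ := τ)
    (T := LinearMap.mulLeft ℂ (star a)) (C := ‖star a‖)
    (fun x => PositiveLinearMap.norm_gnsVec_mul_le _ x)
  obtain ⟨R, hR⟩ := PositiveLinearMap.exists_clm_of_norm_gnsVec_le (τ := τ)
    (T := LinearMap.mulRight ℂ a) (C := ‖a‖) (fun x => h.norm_gnsVec_mul_le_right x a)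
  have happ : ∀ x, (LinearMap.mulRight ℂ a ∘ₗ LinearMap.mulLeft ℂ (star a) ∘ₗ T.toLinearMap) x
      = a * T x * a := by
    intro x
    rw [hasa]
    rfl
  refine ⟨LinearMap.mulRight ℂ a ∘ₗ LinearMap.mulLeft ℂ (star a) ∘ₗ T.toLinearMap,
    R ∘L L ∘L S₀, fun x hx => ?_, ?_, fun x hx => ?_,
    (PositiveLinearMap.isTraceCompletelyPositive_of_completelyPositive τ T).conj a,
    (hS₀.clm_comp L).clm_comp R, fun x => ?_, fun x => ?_⟩
  · rw [happ]
    simpa [hasa] using star_left_conjugate_nonneg (hTpos x hx) a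
  · rw [happ]
    exact hab
  -- Here `τ (a * T x * a) = τ (T x * (a * a)) ≤ τ (T x)` in real parts, because `a * a ≤ 1`.
  · rw [happ, mul_assoc, h.tracial, mul_assoc]
    refine ((h.re_mul_le (hTpos x hx) haa).trans ?_)
    rw [mul_one]
    exact (Complex.le_def.mp (hT x hx)).1
  · have h0 : S₀ (τ.gnsVec x) = τ.gnsVec (T.toLinearMap x) := hS₀T x
    rw [ContinuousLinearMap.comp_apply, ContinuousLinearMap.comp_apply, h0, hL, hR]
    rfl
  · rw [happ]
    -- The last two terms sum to `a * x * a - x`. Each carries a factor `a - 1`, whose `L²` norm is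
    -- at most that of `T 1 - 1`.
    have e : a * T x * a - x = a * (T x - x) * a + ((a - 1) * (x * a) + x * (a - 1)) := by
      noncomm_ring
    have hcut : ‖τ.gnsVec (a - 1)‖ ≤ ‖τ.gnsVec (T 1 - 1)‖ :=
      PositiveLinearMap.norm_gnsVec_le_of_le ha
    have h1 : ‖τ.gnsVec (a * (T x - x) * a)‖ ≤ ‖τ.gnsVec (T x - x)‖ := by
      refine (h.norm_gnsVec_mul_le_right _ _).trans ?_
      refine (mul_le_of_le_one_left (norm_nonneg _) han).trans ?_
      exact (PositiveLinearMap.norm_gnsVec_mul_le _ _).trans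
        (mul_le_of_le_one_left (norm_nonneg _) han)
    have h2 : ‖τ.gnsVec ((a - 1) * (x * a))‖ ≤ ‖x‖ * ‖τ.gnsVec (T 1 - 1)‖ := by
      refine (h.norm_gnsVec_mul_le_right _ _).trans ?_
      have : ‖x * a‖ ≤ ‖x‖ :=
        (norm_mul_le _ _).trans (mul_le_of_le_one_right (norm_nonneg _) han)
      gcongr
    have h3 : ‖τ.gnsVec (x * (a - 1))‖ ≤ ‖x‖ * ‖τ.gnsVec (T 1 - 1)‖ :=
      (PositiveLinearMap.norm_gnsVec_mul_le _ _).trans (by gcongr)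
    rw [e, map_add, map_add]
    have h4 := norm_add_le (τ.gnsVec (a * (T x - x) * a))
      (τ.gnsVec ((a - 1) * (x * a)) + τ.gnsVec (x * (a - 1)))
    have h5 := norm_add_le (τ.gnsVec ((a - 1) * (x * a))) (τ.gnsVec (x * (a - 1)))
    linarith

/-- The map `T₁⋆ ∘ T₁` built from the cut-down `T₁` of a completely positive map `T`. -/
lemma exists_symmetric_map (hτ : M.IsFaithfulNormalTrace τ) (T : M →CP M)
    (hT : ∀ x : M, 0 ≤ x → τ (T x) ≤ τ x) (hc : M.ExtendsToCompact τ T.toLinearMap) :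
    ∃ R T₁ : M →ₗ[ℂ] M, M.IsNormalMap R ∧ M.cbNorm R ≤ 1 ∧ (∀ x, ‖R x‖ ≤ ‖x‖) ∧
      (∀ x y : M, τ (star y * R x) = τ (star (R y) * x)) ∧ M.ExtendsToCompact τ R ∧
      (∀ x y, τ (star y * R x) = inner ℂ (τ.gnsVec (T₁ y)) (τ.gnsVec (T₁ x))) ∧
      ∀ x, ‖τ.gnsVec (T₁ x - x)‖ ≤
        ‖τ.gnsVec (T x - x)‖ + 2 * ‖x‖ * ‖τ.gnsVec (T 1 - 1)‖ := by
  have h := hτ.isFaithfulTracialState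
  obtain ⟨T₁, S, hpos, hone, htr, hcp, hS, hST, hnear⟩ := hτ.exists_contractive_cutoff T hT hc
  have hstar : ∀ x, T₁ (star x) = star (T₁ x) := fun x =>
    map_star (PositiveLinearMap.mk₀ T₁ hpos) x
  obtain ⟨T₂, hST₂, hstar₂, hone₂, hadj⟩ :=
    h.exists_adjoint hτ.isClosed_gnsVec_image_Icc hpos hstar htr hST
  have hcp₂ := hcp.of_adjoint h hadj
  have hinner : ∀ x y, τ (star y * (T₂ ∘ₗ T₁) x)
      = inner ℂ (τ.gnsVec (T₁ y)) (τ.gnsVec (T₁ x)) := by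
    intro x y
    rw [← PositiveLinearMap.inner_gnsVec, LinearMap.comp_apply, ← hST₂,
      ContinuousLinearMap.adjoint_inner_right, hST]
  have hinner' : ∀ x y, τ (star ((T₂ ∘ₗ T₁) y) * x)
      = inner ℂ (τ.gnsVec (T₁ y)) (τ.gnsVec (T₁ x)) := by
    intro x y
    rw [← PositiveLinearMap.inner_gnsVec, LinearMap.comp_apply, ← hST₂,
      ContinuousLinearMap.adjoint_inner_left, hST]
  have hRstar : ∀ x, (T₂ ∘ₗ T₁) (star x) = star ((T₂ ∘ₗ T₁) x) := fun x => by
    rw [LinearMap.comp_apply, hstar, hstar₂, LinearMap.comp_apply]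
  have hcb : ∀ (n : ℕ) (X : CStarMatrix (Fin n) (Fin n) M), ‖X‖ ≤ 1 →
      ‖X.map (T₂ ∘ₗ T₁)‖ ≤ 1 := fun n X hX =>
    hcp₂.norm_map_le_one h hstar₂ hone₂ (X.map T₁) (hcp.norm_map_le_one h hstar hone X hX)
  have hsym : ∀ x y : M, τ (star y * (T₂ ∘ₗ T₁) x) = τ (star ((T₂ ∘ₗ T₁) y) * x) :=
    fun x y => (hinner x y).trans (hinner' x y).symm
  refine ⟨T₂ ∘ₗ T₁, T₁, ?_, cbNorm_le_one_of_norm_map_le hcb, norm_apply_le_of_norm_map_le hcb,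
    hsym, ⟨S.adjoint ∘L S, hS.clm_comp S.adjoint, fun x => ?_⟩, hinner, hnear⟩
  -- By symmetry, `R` is its own adjoint for the trace.
  · refine hτ.isNormalMap_of_adjoint (R' := T₂ ∘ₗ T₁) (norm_apply_le_of_norm_map_le hcb)
      fun z x => ?_
    have := hsym x (star z)
    rwa [hRstar, star_star, star_star] at this
  · change S.adjoint (S (τ.gnsVec x)) = τ.gnsVec (T₂ (T₁ x))
    rw [hST, hST₂]

/-- The index set is kept. Since `T₁ x → x` in `L²`, the pairing `τ (z * R x) = ⟨T₁ x, T₁ (star z)⟩`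
tends to `τ (z * x)`, and boundedness of the net upgrades this to ultraweak convergence. -/
lemma hasWeakHaagerupNet_one (hτ : M.IsFaithfulNormalTrace τ) (hM : M.HasHaagerupProperty τ) :
    M.HasWeakHaagerupNet τ 1 := by
  obtain ⟨A, i₁, i₂, i₃, T, -, hT, hc, hlim⟩ := hM
  choose R T₁ hnormal hcb hcontr hsym hcpt hinner hnear using
    fun a => hτ.exists_symmetric_map (T a) (hT a) (hc a)
  refine ⟨A, i₁, i₂, i₃, R, hnormal, fun a => (hcb a).trans_lt ENNReal.one_lt_top,
    fun a => by simpa using hcb a, hsym, hcpt, fun x => ?_⟩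
  have hlim' : ∀ x : M, Filter.Tendsto (fun a => ‖τ.gnsVec (T a x - x)‖) Filter.atTop (𝓝 0) := hlim
  have hT₁ : ∀ x : M, Filter.Tendsto (fun a => τ.gnsVec (T₁ a x)) Filter.atTop
      (𝓝 (τ.gnsVec x)) := by
    intro x
    rw [tendsto_iff_norm_sub_tendsto_zero]
    have h1 : Filter.Tendsto (fun a => ‖τ.gnsVec (T a x - x)‖ +
        2 * ‖x‖ * ‖τ.gnsVec (T a 1 - 1)‖) Filter.atTop (𝓝 0) := by
      simpa using (hlim' x).add ((hlim' 1).const_mul (2 * ‖x‖))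
    refine squeeze_zero (fun _ => norm_nonneg _) (fun a => ?_) h1
    rw [← map_sub]
    exact hnear a x
  refine hτ.tendsto_ultraweak_of_tendsto_trace (C := 2 * ‖x‖) (fun a => ?_) fun z => ?_
  · have := norm_sub_le (R a x) x
    have := hcontr a x
    linarith
  · have h1 := (((hT₁ (star z)).inner (𝕜 := ℂ) (hT₁ x)).sub_const
      (inner ℂ (τ.gnsVec (star z)) (τ.gnsVec x)))
    rw [sub_self] at h1
    refine h1.congr fun a => ?_
    rw [← hinner, PositiveLinearMap.inner_gnsVec, star_star, mul_sub, map_sub]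

/-- By normality of `τ`, `|τ (R 1)|` tends to `τ 1 = 1` along the net, while `|τ (R 1)| ≤ ‖R 1‖ ≤
‖R‖_cb ≤ C`. -/
lemma one_le_of_hasWeakHaagerupNet (hτ : M.IsFaithfulNormalTrace τ) {C : ℝ} (hC : 0 < C)
    (hM : M.HasWeakHaagerupNet τ C) : 1 ≤ C := by
  obtain ⟨A, i₁, i₂, i₃, R, -, -, hcb, -, -, hlim⟩ := hM
  have h := hτ.isFaithfulTracialState
  have h1 : Filter.Tendsto (fun a => ‖τ (R a 1)‖) Filter.atTop (𝓝 ‖τ 1‖) :=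
    let _ : TopologicalSpace M := M.ultraweakTopology
    ((hτ.normal.tendsto 1).comp (hlim 1)).norm
  rw [hτ.map_one, norm_one] at h1
  refine le_of_tendsto' h1 fun a => ?_
  have h2 : ‖R a 1‖ ≤ C := by
    have := (norm_apply_one_le_cbNorm (R a)).trans (hcb a)
    rwa [← ofReal_norm, ENNReal.ofReal_le_ofReal_iff hC.le] at this
  refine le_trans ?_ h2
  have h3 := PositiveLinearMap.inner_gnsVec (τ := τ) 1 (R a 1)
  rw [star_one, one_mul] at h3
  rw [← h3]
  refine (norm_inner_le_norm _ _).trans ?_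
  rw [h.norm_gnsVec_one, one_mul]
  exact h.norm_gnsVec_le _

end IsFaithfulNormalTrace

end VonNeumannAlgebra

end

theorem mainTheorem9 {H : Type*} [NormedAddCommGroup H] [InnerProductSpace ℂ H] [CompleteSpace H]
    (M : VonNeumannAlgebra H) (τ : M →ₚ[ℂ] ℂ) (hτ : M.IsFaithfulNormalTrace τ)
    (hM : M.HasHaagerupProperty τ) :
    M.HasWeakHaagerupProperty τ ∧ M.weakHaagerupConstant τ = 1 := by
  have hnet := hτ.hasWeakHaagerupNet_one hM
  refine ⟨⟨1, one_pos, hnet⟩, le_antisymm ?_ ?_⟩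
  · exact iInf_le_of_le 1 (iInf_le_of_le one_pos (iInf_le_of_le hnet (by simp)))
  · refine le_iInf fun C => le_iInf fun hC => le_iInf fun hC' => ?_
    rw [ENNReal.one_le_ofReal]
    exact hτ.one_le_of_hasWeakHaagerupNet hC hC'
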